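/- Let $K$ be an algebraically closed field of characteristic $0$ and let $X$ be a smooth integral $K$-scheme (for instance, a smooth irreducible quasi-projective variety over $K$), with structure sheaf $\mathcal A$ and tangent sheaf $\mathcal V$; thus $\mathcal V(U)=\mathrm{Der}_K\,\mathcal A(U)$ for every affine open $U\subset X$. For a Rinehart pair $(A,G)$ (a commutative $K$-algebra $A$ and a $K$-Lie algebra $G$ that is an $A$-module and acts on $A$ by derivations, with $(ag)(b)=a\,g(b)$ and $[g_1,ag_2]=g_1(a)g_2+a[g_1,g_2]$) let $U(A,G)=A\#\mathcal U(G)$ be the weak Rinehart enveloping algebra, generated by the algebra $A$ and the Lie algebra $G$ subject to $g\cdot a=a\cdot g+g(a)$, and let $D(A,G)$ be the strong Rinehart enveloping algebra, the quotient of $U(A,G)$ by the two-sided ideal generated by all $a\cdot g-ag$ with $a\in A$, $g\in G$. For an affine open $U$ put $A=\mathcal A(U)$, $V=\mathcal V(U)$, let $\Delta$ be the kernel of the multiplication $A\otimes_K A\to A$, and let $A\# V=A\otimes_K V=(A\otimes_K A)\otimes_A V$ be the Lie algebra with bracket $$[a_1\# g_1,a_2\# g_2]=a_1g_1(a_2)\#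 g_2-a_2g_2(a_1)\# g_1+a_1a_2\#[g_1,g_2].$$ The Lie algebra of jets of vector fields on $U$ is $\widehat{\mathcal J}(U)=\varprojlim_k\,(A\# V)/(\Delta^k\otimes_A V)$; it acts on $A$ by $(a\# g)(b)=a\,g(b)$, so that $(A,\widehat{\mathcal J}(U))$ is a Rinehart pair. Let $\mathrm{weak}_{\mathrm{fin}}\mathcal V$ be the category of finitely generated quasi-coherent $\mathcal A$-modules $\mathcal M$ with a compatible action of the Lie algebra sheaf $\mathcal V$, meaning $\eta(fm)=f(\eta m)+\eta(f)m$; equivalently, $\mathcal M$ is a module over the sheaf of algebras $U(\mathcal A,\mathcal V)$ (on affine open sets). Let $\mathrm{strong}_{\mathrm{fin}}\widehat{\mathcal J}$ be the category of modules over the sheaf of algebras $D(\mathcal A,\widehat{\mathcal J})$ (on affine open sets) whose underlying $\mathcal A$-module is quasi-coherent and finitely generated. The morphisms are the module homomorphisms. Then there is an equivalence of categories $$\mathrm{weak}_{\mathrm{fin}}\mathcal V\simeq\mathrm{strong}_{\mathrm{fin}}\widehat{\mathcal J},$$ and it can be chosen so that its quasi-inverse is the restriction of scalars along the canonical homomorphism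 $U(\mathcal A,\mathcal V)\to D(\mathcal A,\widehat{\mathcal J})$, $f\mapsto f$, $\eta\mapsto 1\#\eta$. -/

import Mathlib

open CategoryTheory AlgebraicGeometry
open scoped TensorProduct
universe u

noncomputable section

/-- The underlying space `A ⊗[K] G` of the Lie algebra `A # G` of a Rinehart pair `(A, G)`. -/
def SmashLie (K A G : Type*) [CommRing K] [CommRing A] [Algebra K A] [LieRing G]
    [LieAlgebra K G] := A ⊗[K] G

namespace SmashLie

section Basic
variable (K A G : Type*) [CommRing K] [CommRing A] [Algebra K A] [LieRing G] [LieAlgebra K G]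

instance : AddCommGroup (SmashLie K A G) := inferInstanceAs (AddCommGroup (A ⊗[K] G))
instance : Module K (SmashLie K A G) := inferInstanceAs (Module K (A ⊗[K] G))
/-- `A` acts on the left tensor factor. -/
instance : Module A (SmashLie K A G) := inferInstanceAs (Module A (A ⊗[K] G))
instance : IsScalarTower K A (SmashLie K A G) := inferInstanceAs (IsScalarTower K A (A ⊗[K] G))

variable {A G} in
/-- The element `a # g`. -/
def tmul (a : A) (g : G) : SmashLie K A G := a ⊗ₜ[K] g

variable {K A G} in
@[elab_as_elim]
theorem induction {p : SmashLie K A G → Prop} (x : SmashLie K A G) (h0 : p 0)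
    (ht : ∀ a g, p (tmul K a g)) (ha : ∀ x y, p x → p y → p (x + y)) : p x :=
  TensorProduct.induction_on (motive := fun z => p z) x h0 ht ha

variable {K A G}
theorem add_tmul (a b : A) (g : G) : tmul K (a + b) g = tmul K a g + tmul K b g :=
  TensorProduct.add_tmul a b g
theorem sub_tmul (a b : A) (g : G) : tmul K (a - b) g = tmul K a g - tmul K b g :=
  TensorProduct.sub_tmul a b g
theorem neg_tmul (a : A) (g : G) : tmul K (-a) g = -tmul K a g := TensorProduct.neg_tmul a g
theorem tmul_add (a : A) (g h : G) : tmul K a (g + h) = tmul K a g + tmul K a h :=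
  TensorProduct.tmul_add a g h
theorem tmul_sub (a : A) (g h : G) : tmul K a (g - h) = tmul K a g - tmul K a h :=
  TensorProduct.tmul_sub a g h
theorem smul_tmul' (a b : A) (g : G) : a • tmul K b g = tmul K (a * b) g :=
  TensorProduct.smul_tmul' a b g
theorem tmul_eq (a : A) (g : G) : tmul K a g = a • tmul K 1 g := by
  rw [smul_tmul', mul_one]

end Basic

section Bracket
variable (K A G : Type*) [CommRing K] [CommRing A] [Algebra K A] [LieRing G] [LieAlgebra K G]
  [Module A G] [LieRingModule G A] [LieRinehartRing A G] [LieRinehartAlgebra K A G]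

/-- The bilinear map `(a₁ # g₁, a₂ # g₂) ↦ a₁ g₁(a₂) # g₂`. -/
def anchorTerm : (A ⊗[K] G) →ₗ[K] (A ⊗[K] G) →ₗ[K] (A ⊗[K] G) :=
  TensorProduct.lift <| LinearMap.mk₂ K
    (fun a g => LinearMap.rTensor G (LinearMap.mulLeft K a ∘ₗ LieModule.toEnd K G A g))
    (fun a b g => by ext; simp [add_mul, TensorProduct.add_tmul])
    (fun c a g => by ext; simp [TensorProduct.smul_tmul'])
    (fun a g h => by ext; simp [mul_add, TensorProduct.add_tmul])
    (fun c a g => by ext; simp [TensorProduct.smul_tmul'])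

/-- The bracket
`[a₁ # g₁, a₂ # g₂] = a₁ g₁(a₂) # g₂ - a₂ g₂(a₁) # g₁ + a₁ a₂ # [g₁, g₂]`;
see `SmashLie.tmul_lie_tmul`. -/
def bracketFun (x y : A ⊗[K] G) : A ⊗[K] G :=
  anchorTerm K A G x y - anchorTerm K A G y x + ⁅x, y⁆

instance : Bracket (SmashLie K A G) (SmashLie K A G) where
  bracket := bracketFun K A G

variable {K A G}

theorem tmul_lie_tmul (a b : A) (g h : G) :
    ⁅tmul K a g, tmul K b h⁆
      = tmul K (a * ⁅g, b⁆) h - tmul K (b * ⁅h, a⁆) g + tmul K (a * b) ⁅g, h⁆ := rfl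

protected theorem add_lie' (x y z : SmashLie K A G) : ⁅x + y, z⁆ = ⁅x, z⁆ + ⁅y, z⁆ := by
  have h : ∀ x y z : A ⊗[K] G, (anchorTerm K A G (x + y) z - anchorTerm K A G z (x + y)
      + ⁅x + y, z⁆ : A ⊗[K] G) = (anchorTerm K A G x z - anchorTerm K A G z x + ⁅x, z⁆)
      + (anchorTerm K A G y z - anchorTerm K A G z y + ⁅y, z⁆) := by
    intro x y z
    rw [map_add, map_add, add_lie, LinearMap.add_apply]; abel
  exact h x y z

protected theorem lie_add' (x y z : SmashLie K A G) : ⁅x, y + z⁆ = ⁅x, y⁆ + ⁅x, z⁆ := by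
  have h : ∀ x y z : A ⊗[K] G, (anchorTerm K A G x (y + z) - anchorTerm K A G (y + z) x
      + ⁅x, y + z⁆ : A ⊗[K] G) = (anchorTerm K A G x y - anchorTerm K A G y x + ⁅x, y⁆)
      + (anchorTerm K A G x z - anchorTerm K A G z x + ⁅x, z⁆) := by
    intro x y z
    rw [map_add, map_add, lie_add, LinearMap.add_apply]; abel
  exact h x y z

protected theorem lie_self' (x : SmashLie K A G) : ⁅x, x⁆ = 0 := by
  have h : ∀ x : A ⊗[K] G, (anchorTerm K A G x x - anchorTerm K A G x x
      + ⁅x, x⁆ : A ⊗[K] G) = 0 := by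
    intro x; simp
  exact h x

protected theorem leibniz' (x y z : SmashLie K A G) :
    ⁅x, ⁅y, z⁆⁆ = ⁅⁅x, y⁆, z⁆ + ⁅y, ⁅x, z⁆⁆ := by
  have z1 : ∀ x : SmashLie K A G, ⁅x, (0 : SmashLie K A G)⁆ = 0 := fun x => by
    have := SmashLie.lie_add' x 0 0; simpa using this
  have z2 : ∀ x : SmashLie K A G, ⁅(0 : SmashLie K A G), x⁆ = 0 := fun x => by
    have := SmashLie.add_lie' 0 0 x; simpa using this
  have n1 : ∀ x y : SmashLie K A G, ⁅x, -y⁆ = -⁅x, y⁆ := fun x y => by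
    have := SmashLie.lie_add' x y (-y); rw [add_neg_cancel, z1] at this
    exact (neg_eq_of_add_eq_zero_right this.symm).symm
  have n2 : ∀ x y : SmashLie K A G, ⁅-x, y⁆ = -⁅x, y⁆ := fun x y => by
    have := SmashLie.add_lie' x (-x) y; rw [add_neg_cancel, z2] at this
    exact (neg_eq_of_add_eq_zero_right this.symm).symm
  induction x using SmashLie.induction with
  | h0 => simp [z1, z2]
  | ha x x' hx hx' => simp only [SmashLie.add_lie', SmashLie.lie_add', hx, hx']; abel
  | ht a f =>
  induction y using SmashLie.induction with
  | h0 => simp [z1, z2]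
  | ha x x' hx hx' => simp only [SmashLie.add_lie', SmashLie.lie_add', hx, hx']; abel
  | ht b g =>
  induction z using SmashLie.induction with
  | h0 => simp [z1]
  | ha x x' hx hx' => simp only [SmashLie.lie_add', hx, hx']; abel
  | ht c h =>
  simp only [tmul_lie_tmul, sub_eq_add_neg, SmashLie.add_lie', SmashLie.lie_add', n1, n2,
    LieRinehartRing.leibniz_mul_right, smul_eq_mul]
  have e1 : ⁅g, f⁆ = -⁅f, g⁆ := (lie_skew g f).symm
  have t1 : ∀ (a : A) (x : G), tmul K a (-x) = -tmul K a x := TensorProduct.tmul_neg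
  simp only [e1, t1, lie_lie, mul_add, add_tmul, mul_sub, sub_tmul, tmul_sub,
    mul_comm, mul_left_comm]
  abel

instance : LieRing (SmashLie K A G) where
  add_lie := SmashLie.add_lie'
  lie_add := SmashLie.lie_add'
  lie_self := SmashLie.lie_self'
  leibniz_lie := SmashLie.leibniz'

instance : LieAlgebra K (SmashLie K A G) where
  lie_smul c x y := by
    induction x using SmashLie.induction with
    | h0 => simp
    | ha x x' hx hx' => simp only [add_lie, hx, hx', smul_add]
    | ht a g =>
    induction y using SmashLie.induction with
    | h0 => simp
    | ha x x' hx hx' => simp only [lie_add, hx, hx', smul_add]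
    | ht b h =>
      have e : ∀ (a : A) (g : G), c • tmul K a g = tmul K (c • a) g := fun a g =>
        TensorProduct.smul_tmul' c a g
      have e' : ⁅g, c • b⁆ = c • ⁅g, b⁆ := lie_smul c g b
      simp only [e, e', tmul_lie_tmul, smul_add, smul_sub, mul_smul_comm, smul_mul_assoc]

/-- The action of `A # G` on `A` as a linear map in both variables. -/
def actionMap (K A G : Type*) [CommRing K] [CommRing A] [Algebra K A] [LieRing G] [LieAlgebra K G]
    [Module A G] [LieRingModule G A] [LieRinehartRing A G] [LieRinehartAlgebra K A G] :
    (A ⊗[K] G) →ₗ[K] A →ₗ[K] A :=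
  TensorProduct.lift <| LinearMap.mk₂ K
    (fun a g => LinearMap.mulLeft K a ∘ₗ LieModule.toEnd K G A g)
    (fun a b g => by ext; simp [add_mul])
    (fun c a g => by ext; simp)
    (fun a g h => by ext; simp [mul_add])
    (fun c a g => by ext; simp)

/-- The anchor: `a # g` acts on `A` by `b ↦ a g(b)`. -/
instance : Bracket (SmashLie K A G) A where
  bracket x b := actionMap K A G x b

theorem tmul_lie (a b : A) (g : G) : ⁅tmul K a g, b⁆ = a * ⁅g, b⁆ := rfl

protected theorem add_lie_base (x y : SmashLie K A G) (b : A) : ⁅x + y, b⁆ = ⁅x, b⁆ + ⁅y, b⁆ :=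
  congrArg (fun f : A →ₗ[K] A => f b) (map_add (actionMap K A G) x y)
protected theorem lie_add_base (x : SmashLie K A G) (b c : A) : ⁅x, b + c⁆ = ⁅x, b⁆ + ⁅x, c⁆ :=
  map_add (actionMap K A G x) b c
protected theorem lie_smul_base (x : SmashLie K A G) (k : K) (b : A) : ⁅x, k • b⁆ = k • ⁅x, b⁆ :=
  map_smul (actionMap K A G x) k b
protected theorem smul_lie_base (x : SmashLie K A G) (k : K) (b : A) : ⁅k • x, b⁆ = k • ⁅x, b⁆ :=
  congrArg (fun f : A →ₗ[K] A => f b) (map_smul (actionMap K A G) k x)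
protected theorem zero_lie_base (b : A) : ⁅(0 : SmashLie K A G), b⁆ = 0 :=
  congrArg (fun f : A →ₗ[K] A => f b) (map_zero (actionMap K A G))
protected theorem sub_lie_base (x y : SmashLie K A G) (b : A) : ⁅x - y, b⁆ = ⁅x, b⁆ - ⁅y, b⁆ :=
  congrArg (fun f : A →ₗ[K] A => f b) (map_sub (actionMap K A G) x y)

protected theorem leibniz_base (x y : SmashLie K A G) (b : A) :
    ⁅x, ⁅y, b⁆⁆ = ⁅⁅x, y⁆, b⁆ + ⁅y, ⁅x, b⁆⁆ := by
  induction x using SmashLie.induction with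
  | h0 => rw [zero_lie, SmashLie.zero_lie_base, SmashLie.zero_lie_base]
          exact ((zero_add _).trans (map_zero (actionMap K A G y))).symm
  | ha x x' hx hx' =>
    simp only [SmashLie.add_lie_base, SmashLie.lie_add_base, add_lie, hx, hx']; abel
  | ht a g =>
  induction y using SmashLie.induction with
  | h0 => rw [lie_zero, SmashLie.zero_lie_base, SmashLie.zero_lie_base]
          exact (map_zero (actionMap K A G (tmul K a g))).trans (add_zero 0).symm
  | ha x x' hx hx' =>
    simp only [SmashLie.add_lie_base, SmashLie.lie_add_base, lie_add, hx, hx']; abel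
  | ht c h =>
    simp only [tmul_lie_tmul, tmul_lie, SmashLie.add_lie_base, SmashLie.sub_lie_base,
      LieRinehartRing.leibniz_mul_right, smul_eq_mul, lie_lie]
    ring

instance : LieRingModule (SmashLie K A G) A where
  add_lie := SmashLie.add_lie_base
  lie_add := SmashLie.lie_add_base
  leibniz_lie := SmashLie.leibniz_base

instance : LieModule K (SmashLie K A G) A where
  smul_lie k x b := SmashLie.smul_lie_base x k b
  lie_smul k x b := SmashLie.lie_smul_base x k b

/-- `(A, A # G)` is again a Rinehart pair. -/
instance : LieRinehartRing A (SmashLie K A G) where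
  lie_smul_eq_mul' a b x := by
    induction x using SmashLie.induction with
    | h0 => simp
    | ha x x' hx hx' => simp only [smul_add, add_lie, hx, hx', mul_add]
    | ht c g => simp only [smul_tmul', tmul_lie, mul_assoc]
  leibniz_mul_right' x a b := by
    induction x using SmashLie.induction with
    | h0 => simp
    | ha x x' hx hx' => simp only [smul_add, add_lie, hx, hx', add_mul]; abel
    | ht c g =>
      simp only [tmul_lie, LieRinehartRing.leibniz_mul_right, smul_eq_mul]; ring
  leibniz_smul_right' x y a := by
    induction x using SmashLie.induction with
    | h0 => simp
    | ha x x' hx hx' => simp only [smul_add, add_lie, hx, hx', add_smul]; abel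
    | ht c g =>
    induction y using SmashLie.induction with
    | h0 => simp
    | ha x x' hx hx' => simp only [smul_add, lie_add, hx, hx']; abel
    | ht b h =>
      simp only [tmul_lie_tmul, smul_tmul', tmul_lie, LieRinehartRing.leibniz_mul_right,
        smul_eq_mul, mul_add, add_tmul, smul_add, smul_sub, mul_comm, mul_left_comm]
      abel

instance : LieRinehartAlgebra K A (SmashLie K A G) where

end Bracket

section Diagonal
variable (K A G : Type*) [CommRing K] [CommRing A] [Algebra K A] [LieRing G] [LieAlgebra K G]
  [Module A G] [IsScalarTower K A G]

/-- The action of `A ⊗ A` on `A # G = (A ⊗ A) ⊗_A G`: `(c ⊗ d)(a # g) = ca # dg`. -/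
def leftRightAction : A ⊗[K] A →ₐ[K] Module.End K (A ⊗[K] G) :=
  Module.endTensorEndAlgHom.comp
    (Algebra.TensorProduct.map (Algebra.lsmul K K A) (Algebra.lsmul K K G))

instance : Module (A ⊗[K] A) (SmashLie K A G) :=
  Module.compHom (A ⊗[K] G) (leftRightAction K A G).toRingHom

variable {K A G}

theorem tmul_smul_tmul (c d a : A) (g : G) :
    (c ⊗ₜ[K] d : A ⊗[K] A) • tmul K a g = tmul K (c * a) (d • g) := rfl

instance : IsScalarTower A (A ⊗[K] A) (SmashLie K A G) where
  smul_assoc a z x := by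
    induction x using SmashLie.induction with
    | h0 => simp
    | ha x x' hx hx' => simp only [smul_add, hx, hx']
    | ht b g =>
    induction z with
    | zero => simp
    | add x x' hx hx' => simp only [smul_add, add_smul, hx, hx']
    | tmul c d => simp only [TensorProduct.smul_tmul', tmul_smul_tmul, smul_tmul', smul_eq_mul,
        mul_assoc]

instance : IsScalarTower K (A ⊗[K] A) (SmashLie K A G) where
  smul_assoc a z x := by
    rw [← algebraMap_smul A a z, smul_assoc, algebraMap_smul]

end Diagonal

section Ideals
variable (K A G : Type*) [CommRing K] [CommRing A] [Algebra K A] [LieRing G] [LieAlgebra K G]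
  [Module A G] [LieRingModule G A] [LieRinehartRing A G] [LieRinehartAlgebra K A G]

/-- The ideal `Δ`, the kernel of the multiplication map `A ⊗ A → A`. -/
abbrev diagIdeal (K A : Type*) [CommRing K] [CommRing A] [Algebra K A] : Ideal (A ⊗[K] A) :=
  KaehlerDifferential.ideal K A

/-- The subspace `J_n = Δⁿ ⊗_A G` of `J = A # G = (A ⊗ A) ⊗_A G`. -/
abbrev jetIdeal (n : ℕ) : Submodule (A ⊗[K] A) (SmashLie K A G) :=
  diagIdeal K A ^ n • ⊤

variable {K A G}

/-- The diagonal action of `g ∈ G` on `A ⊗ A`. -/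
def diagAction (g : G) : A ⊗[K] A →ₗ[K] A ⊗[K] A :=
  LinearMap.rTensor A (LieModule.toEnd K G A g) + LinearMap.lTensor A (LieModule.toEnd K G A g)

theorem diagAction_tmul (g : G) (c d : A) :
    diagAction g (c ⊗ₜ[K] d) = ⁅g, c⁆ ⊗ₜ[K] d + c ⊗ₜ[K] ⁅g, d⁆ := rfl

theorem diagAction_mul (g : G) (z w : A ⊗[K] A) :
    diagAction g (z * w) = diagAction g z * w + z * diagAction g w := by
  induction z with
  | zero => simp
  | add x x' hx hx' => simp only [add_mul, map_add, hx, hx']; abel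
  | tmul c d =>
  induction w with
  | zero => simp
  | add x x' hx hx' => simp only [mul_add, map_add, hx, hx']; abel
  | tmul c' d' =>
    simp only [Algebra.TensorProduct.tmul_mul_tmul, diagAction_tmul,
      LieRinehartRing.leibniz_mul_right, smul_eq_mul, TensorProduct.add_tmul,
      TensorProduct.tmul_add, mul_add, add_mul]
    abel

theorem diagAction_mem_pow (g : G) (n : ℕ) :
    ∀ z ∈ diagIdeal K A ^ n, diagAction g z ∈ diagIdeal K A ^ n := by
  have h1 : ∀ z ∈ diagIdeal K A, diagAction g z ∈ diagIdeal K A := by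
    have key : ∀ z : A ⊗[K] A, Algebra.TensorProduct.lmul' K (S := A) (diagAction g z)
        = ⁅g, Algebra.TensorProduct.lmul' K (S := A) z⁆ := by
      intro z
      induction z with
      | zero => simp
      | add x x' hx hx' => simp only [map_add, lie_add, hx, hx']
      | tmul c d =>
        simp only [diagAction_tmul, map_add, Algebra.TensorProduct.lmul'_apply_tmul,
          LieRinehartRing.leibniz_mul_right, smul_eq_mul]
        ring
    intro z hz
    have hz' : Algebra.TensorProduct.lmul' K (S := A) z = 0 := hz
    change Algebra.TensorProduct.lmul' K (S := A) (diagAction g z) = 0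
    rw [key, hz', lie_zero]
  induction n with
  | zero => simp
  | succ n ih =>
    intro z hz
    rw [pow_succ] at hz ⊢
    induction hz using Submodule.mul_induction_on' with
    | mem_mul_mem x hx y hy =>
      rw [diagAction_mul]
      exact add_mem (Ideal.mul_mem_mul (ih x hx) hy) (Ideal.mul_mem_mul hx (h1 y hy))
    | add x _ y _ hx hy => rw [map_add]; exact add_mem hx hy

/-- The subspaces `J_n` are Lie ideals of `A # G`. -/
theorem lie_mem_jetIdeal (n : ℕ) (x y : SmashLie K A G) (hy : y ∈ jetIdeal K A G n) :
    ⁅x, y⁆ ∈ jetIdeal K A G n := by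
  rcases Nat.eq_zero_or_pos n with rfl | hn
  · simp [jetIdeal]
  have key : ∀ (a b : A) (g h : G) (z : A ⊗[K] A), ⁅tmul K a g, z • tmul K b h⁆
      = ((a ⊗ₜ[K] 1) * diagAction g z) • tmul K b h
        + z • (tmul K (a * ⁅g, b⁆) h + tmul K (a * b) ⁅g, h⁆)
        - Algebra.TensorProduct.lmul' K (S := A) z • tmul K (b * ⁅h, a⁆) g := by
    intro a b g h z
    induction z with
    | zero => simp
    | add x x' hx hx' => simp only [add_smul, lie_add, hx, hx', map_add, mul_add]; abel
    | tmul c d =>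
      simp only [tmul_smul_tmul, tmul_lie_tmul, diagAction_tmul, mul_add, add_smul,
        Algebra.TensorProduct.tmul_mul_tmul, mul_one, LieRinehartRing.leibniz_mul_right,
        LieRinehartRing.leibniz_smul_right, LieRinehartRing.lie_smul_eq_mul, smul_eq_mul,
        smul_add, smul_tmul', Algebra.TensorProduct.lmul'_apply_tmul, add_tmul, tmul_add,
        mul_comm, mul_left_comm]
      abel
  have key2 : ∀ (x y : SmashLie K A G) (z : A ⊗[K] A), z ∈ diagIdeal K A ^ n →
      ⁅x, z • y⁆ ∈ jetIdeal K A G n := by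
    intro x y z hz
    induction x using SmashLie.induction with
    | h0 => simp
    | ha x x' hx hx' => rw [add_lie]; exact add_mem hx hx'
    | ht a g =>
    induction y using SmashLie.induction with
    | h0 => simp
    | ha x x' hx hx' => rw [smul_add, lie_add]; exact add_mem hx hx'
    | ht b h =>
      have h0 : Algebra.TensorProduct.lmul' K (S := A) z = 0 :=
        Ideal.pow_le_self hn.ne' hz
      rw [key, h0, zero_smul, sub_zero]
      exact add_mem (Submodule.smul_mem_smul (Ideal.mul_mem_left _ _ (diagAction_mem_pow g n z hz))
        trivial) (Submodule.smul_mem_smul hz trivial)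
  induction hy using Submodule.smul_induction_on' with
  | smul z hz y _ => exact key2 x y z hz
  | add y _ y' _ h h' => rw [lie_add]; exact add_mem h h'

theorem lie_mem_jetIdeal' (n : ℕ) (x y : SmashLie K A G) (hx : x ∈ jetIdeal K A G n) :
    ⁅x, y⁆ ∈ jetIdeal K A G n := by
  rw [← lie_skew]; exact neg_mem (lie_mem_jetIdeal n y x hx)

/-- `Δ ⊗_A G` is contained in the kernel of the anchor. -/
theorem lie_base_eq_zero (x : SmashLie K A G) (hx : x ∈ jetIdeal K A G 1) (b : A) :
    ⁅x, b⁆ = 0 := by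
  have key : ∀ (z : A ⊗[K] A) (y : SmashLie K A G),
      ⁅z • y, b⁆ = Algebra.TensorProduct.lmul' K (S := A) z * ⁅y, b⁆ := by
    intro z y
    induction y using SmashLie.induction with
    | h0 => simp
    | ha x x' hx hx' => simp only [smul_add, add_lie, hx, hx', mul_add]
    | ht a g =>
    induction z with
    | zero => simp
    | add x x' hx hx' => simp only [add_smul, add_lie, hx, hx', map_add, add_mul]
    | tmul c d =>
      simp only [tmul_smul_tmul, tmul_lie, LieRinehartRing.lie_smul_eq_mul,
        Algebra.TensorProduct.lmul'_apply_tmul]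
      ring
  induction hx using Submodule.smul_induction_on' with
  | smul z hz y _ =>
    have h0 : Algebra.TensorProduct.lmul' K (S := A) z = 0 := Ideal.pow_le_self one_ne_zero hz
    rw [key, h0, zero_mul]
  | add y _ y' _ h h' => rw [add_lie, h, h', add_zero]

end Ideals

end SmashLie

section JetLie
variable (K A G : Type*) [CommRing K] [CommRing A] [Algebra K A] [LieRing G] [LieAlgebra K G]
  [Module A G] [LieRingModule G A] [LieRinehartRing A G] [LieRinehartAlgebra K A G]
open SmashLie

/-- The completion `Ĵ = lim_n (A # G) / (Δⁿ ⊗_A G)`. For `G = Der A` this is the Lie algebra of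
jets of vector fields. -/
def JetLie : Type _ := AdicCompletion (diagIdeal K A) (SmashLie K A G)

namespace JetLie

instance : AddCommGroup (JetLie K A G) :=
  inferInstanceAs (AddCommGroup (AdicCompletion (diagIdeal K A) (SmashLie K A G)))
instance : Module (A ⊗[K] A) (JetLie K A G) :=
  inferInstanceAs (Module (A ⊗[K] A) (AdicCompletion (diagIdeal K A) (SmashLie K A G)))
instance : Module A (JetLie K A G) :=
  inferInstanceAs (Module A (AdicCompletion (diagIdeal K A) (SmashLie K A G)))
instance : Module K (JetLie K A G) :=
  inferInstanceAs (Module K (AdicCompletion (diagIdeal K A) (SmashLie K A G)))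
instance : IsScalarTower K A (JetLie K A G) :=
  inferInstanceAs (IsScalarTower K A (AdicCompletion (diagIdeal K A) (SmashLie K A G)))

variable {K A G}

/-- The image of `s ∈ Ĵ` in `(A # G) / J_n`. -/
def val (s : JetLie K A G) (n : ℕ) : SmashLie K A G ⧸ jetIdeal K A G n := Subtype.val s n

theorem ext {s t : JetLie K A G} (h : ∀ n, s.val n = t.val n) : s = t :=
  Subtype.ext (funext h)

theorem val_add (s t : JetLie K A G) (n : ℕ) : (s + t).val n = s.val n + t.val n := rfl
theorem val_zero (n : ℕ) : (0 : JetLie K A G).val n = 0 := rfl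
theorem val_smul (a : A) (s : JetLie K A G) (n : ℕ) : (a • s).val n = a • s.val n := rfl
theorem val_smul' (a : K) (s : JetLie K A G) (n : ℕ) : (a • s).val n = a • s.val n := rfl

/-- The canonical map `A # G → Ĵ`. -/
def of (x : SmashLie K A G) : JetLie K A G := AdicCompletion.of (diagIdeal K A) _ x

theorem val_of (x : SmashLie K A G) (n : ℕ) : (of x).val n = Submodule.Quotient.mk x := rfl

theorem exists_rep (s : JetLie K A G) (n : ℕ) :
    ∃ x : SmashLie K A G, ∀ m ≤ n, s.val m = Submodule.Quotient.mk x := by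
  obtain ⟨x, hx⟩ := Submodule.Quotient.mk_surjective _ (s.val n)
  refine ⟨x, fun m hm => ?_⟩
  have := s.2 hm
  change AdicCompletion.transitionMap _ _ hm (s.val n) = s.val m at this
  rw [← this, ← hx]; rfl

/-- The bracket on the quotient `(A # G) / J_n`. -/
def quotLie (n : ℕ) : (SmashLie K A G ⧸ jetIdeal K A G n) → (SmashLie K A G ⧸ jetIdeal K A G n) →
    (SmashLie K A G ⧸ jetIdeal K A G n) :=
  Quotient.map₂ (fun x y => ⁅x, y⁆) <| by
    intro x x' hx y y' hy
    have hx' := (Submodule.quotientRel_def _).1 hx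
    have hy' := (Submodule.quotientRel_def _).1 hy
    refine (Submodule.quotientRel_def _).2 ?_
    have e : ⁅x, y⁆ - ⁅x', y'⁆ = ⁅x - x', y⁆ + ⁅x', y - y'⁆ := by
      rw [sub_lie, lie_sub]; abel
    rw [e]
    exact add_mem (lie_mem_jetIdeal' n _ _ hx') (lie_mem_jetIdeal n _ _ hy')

theorem quotLie_mk (n : ℕ) (x y : SmashLie K A G) :
    quotLie n (Submodule.Quotient.mk x) (Submodule.Quotient.mk y)
      = Submodule.Quotient.mk ⁅x, y⁆ := rfl

/-- The bracket on `Ĵ`, induced by the brackets on the quotients `(A # G) / J_n`. -/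
instance : Bracket (JetLie K A G) (JetLie K A G) where
  bracket s t := ⟨fun n => quotLie n (s.val n) (t.val n), by
    intro m n hmn
    obtain ⟨x, hx⟩ := s.exists_rep n
    obtain ⟨y, hy⟩ := t.exists_rep n
    beta_reduce
    rw [hx n le_rfl, hy n le_rfl, hx m hmn, hy m hmn, quotLie_mk, quotLie_mk]
    rfl⟩

theorem val_lie {s t : JetLie K A G} {n : ℕ} {x y : SmashLie K A G}
    (hx : s.val n = Submodule.Quotient.mk x) (hy : t.val n = Submodule.Quotient.mk y) :
    ⁅s, t⁆.val n = Submodule.Quotient.mk ⁅x, y⁆ := by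
  change quotLie n (s.val n) (t.val n) = _
  rw [hx, hy]; rfl

instance : LieRing (JetLie K A G) where
  add_lie s t u := by
    refine ext fun n => ?_
    obtain ⟨x, hx⟩ := Submodule.Quotient.mk_surjective _ (s.val n)
    obtain ⟨y, hy⟩ := Submodule.Quotient.mk_surjective _ (t.val n)
    obtain ⟨z, hz⟩ := Submodule.Quotient.mk_surjective _ (u.val n)
    have h1 : (s + t).val n = Submodule.Quotient.mk (x + y) := by rw [val_add, ← hx, ← hy]; rfl
    rw [val_lie h1 hz.symm, val_add, val_lie hx.symm hz.symm, val_lie hy.symm hz.symm, add_lie]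
    rfl
  lie_add s t u := by
    refine ext fun n => ?_
    obtain ⟨x, hx⟩ := Submodule.Quotient.mk_surjective _ (s.val n)
    obtain ⟨y, hy⟩ := Submodule.Quotient.mk_surjective _ (t.val n)
    obtain ⟨z, hz⟩ := Submodule.Quotient.mk_surjective _ (u.val n)
    have h1 : (t + u).val n = Submodule.Quotient.mk (y + z) := by rw [val_add, ← hz, ← hy]; rfl
    rw [val_lie hx.symm h1, val_add, val_lie hx.symm hy.symm, val_lie hx.symm hz.symm, lie_add]
    rfl
  lie_self s := by
    refine ext fun n => ?_
    obtain ⟨x, hx⟩ := Submodule.Quotient.mk_surjective _ (s.val n)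
    rw [val_lie hx.symm hx.symm, lie_self]; rfl
  leibniz_lie s t u := by
    refine ext fun n => ?_
    obtain ⟨x, hx⟩ := Submodule.Quotient.mk_surjective _ (s.val n)
    obtain ⟨y, hy⟩ := Submodule.Quotient.mk_surjective _ (t.val n)
    obtain ⟨z, hz⟩ := Submodule.Quotient.mk_surjective _ (u.val n)
    rw [val_add, val_lie hx.symm (val_lie hy.symm hz.symm),
      val_lie (val_lie hx.symm hy.symm) hz.symm, val_lie hy.symm (val_lie hx.symm hz.symm),
      leibniz_lie]
    rfl

instance : LieAlgebra K (JetLie K A G) where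
  lie_smul c s t := by
    refine ext fun n => ?_
    obtain ⟨x, hx⟩ := Submodule.Quotient.mk_surjective _ (s.val n)
    obtain ⟨y, hy⟩ := Submodule.Quotient.mk_surjective _ (t.val n)
    have h1 : (c • t).val n = Submodule.Quotient.mk (c • y) := by rw [val_smul', ← hy]; rfl
    rw [val_lie hx.symm h1, val_smul', val_lie hx.symm hy.symm, lie_smul]
    rfl

/-- The anchor of `Ĵ`: the action of `Ĵ` on `A` through `(A # G) / J_1`. -/
instance : Bracket (JetLie K A G) A where
  bracket s b := Quotient.liftOn' (s.val 1) (fun x => ⁅x, b⁆) <| by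
    intro x y h
    have h' := (Submodule.quotientRel_def _).1 h
    have := lie_base_eq_zero _ h' b
    rwa [sub_lie, sub_eq_zero] at this

theorem lie_base {s : JetLie K A G} {x : SmashLie K A G}
    (hx : s.val 1 = Submodule.Quotient.mk x) (b : A) : ⁅s, b⁆ = ⁅x, b⁆ := by
  change Quotient.liftOn' (s.val 1) _ _ = _
  rw [hx]; rfl

instance : LieRingModule (JetLie K A G) A where
  add_lie s t b := by
    obtain ⟨x, hx⟩ := Submodule.Quotient.mk_surjective _ (s.val 1)
    obtain ⟨y, hy⟩ := Submodule.Quotient.mk_surjective _ (t.val 1)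
    have h1 : (s + t).val 1 = Submodule.Quotient.mk (x + y) := by rw [val_add, ← hx, ← hy]; rfl
    rw [lie_base h1, lie_base hx.symm, lie_base hy.symm, add_lie]
  lie_add s a b := by
    obtain ⟨x, hx⟩ := Submodule.Quotient.mk_surjective _ (s.val 1)
    rw [lie_base hx.symm, lie_base hx.symm, lie_base hx.symm, lie_add]
  leibniz_lie s t b := by
    obtain ⟨x, hx⟩ := Submodule.Quotient.mk_surjective _ (s.val 1)
    obtain ⟨y, hy⟩ := Submodule.Quotient.mk_surjective _ (t.val 1)
    rw [lie_base (val_lie hx.symm hy.symm), lie_base hx.symm, lie_base hy.symm, lie_base hx.symm,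
      lie_base hy.symm, leibniz_lie]

instance : LieModule K (JetLie K A G) A where
  smul_lie k s b := by
    obtain ⟨x, hx⟩ := Submodule.Quotient.mk_surjective _ (s.val 1)
    have h1 : (k • s).val 1 = Submodule.Quotient.mk (k • x) := by rw [val_smul', ← hx]; rfl
    rw [lie_base hx.symm, lie_base h1, smul_lie]
  lie_smul k s b := by
    obtain ⟨x, hx⟩ := Submodule.Quotient.mk_surjective _ (s.val 1)
    rw [lie_base hx.symm, lie_base hx.symm, lie_smul]

/-- `(A, Ĵ)` is a Rinehart pair. -/
instance : LieRinehartRing A (JetLie K A G) where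
  lie_smul_eq_mul' a b s := by
    obtain ⟨x, hx⟩ := Submodule.Quotient.mk_surjective _ (s.val 1)
    have h1 : (a • s).val 1 = Submodule.Quotient.mk (a • x) := by rw [val_smul, ← hx]; rfl
    rw [lie_base hx.symm, lie_base h1, LieRinehartRing.lie_smul_eq_mul]
  leibniz_mul_right' s a b := by
    obtain ⟨x, hx⟩ := Submodule.Quotient.mk_surjective _ (s.val 1)
    rw [lie_base hx.symm, lie_base hx.symm, lie_base hx.symm, LieRinehartRing.leibniz_mul_right]
  leibniz_smul_right' s t a := by
    refine ext fun n => ?_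
    obtain ⟨x, hx⟩ := s.exists_rep (n + 1)
    obtain ⟨y, hy⟩ := Submodule.Quotient.mk_surjective _ (t.val n)
    have h1 : (a • t).val n = Submodule.Quotient.mk (a • y) := by rw [val_smul, ← hy]; rfl
    have hxn := hx n (Nat.le_succ n)
    rw [val_lie hxn h1, val_add, val_smul, val_smul, val_lie hxn hy.symm, ← hy,
      lie_base (hx 1 (Nat.le_add_left 1 n)), LieRinehartRing.leibniz_smul_right]
    rfl

instance : LieRinehartAlgebra K A (JetLie K A G) where

end JetLie
end JetLie
end

noncomputable section
section Functoriality

variable {K A B C G H L : Type*} [CommRing K]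
  [CommRing A] [Algebra K A] [LieRing G] [LieAlgebra K G]
  [Module A G] [LieRingModule G A] [LieRinehartRing A G] [LieRinehartAlgebra K A G]
  [CommRing B] [Algebra K B] [LieRing H] [LieAlgebra K H]
  [Module B H] [LieRingModule H B] [LieRinehartRing B H] [LieRinehartAlgebra K B H]
  [CommRing C] [Algebra K C] [LieRing L] [LieAlgebra K L]
  [Module C L] [LieRingModule L C] [LieRinehartRing C L] [LieRinehartAlgebra K C L]
  {σ : A →ₐ[K] B} {τ : B →ₐ[K] C}

namespace SmashLie

/-- The map `A # G → B # H`, `a # g ↦ σ(a) # F(g)`, induced by a morphism of Rinehart pairs. -/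
def map (F : LieRinehartAlgebra.Hom σ G H) : SmashLie K A G →ₗ[K] SmashLie K B H :=
  TensorProduct.map σ.toLinearMap F.toLieHom.toLinearMap

theorem map_tmul (F : LieRinehartAlgebra.Hom σ G H) (a : A) (g : G) :
    map F (tmul K a g) = tmul K (σ a) (F g) := rfl

theorem map_lie (F : LieRinehartAlgebra.Hom σ G H) (x y : SmashLie K A G) :
    map F ⁅x, y⁆ = ⁅map F x, map F y⁆ := by
  induction x using SmashLie.induction with
  | h0 => simp
  | ha x x' hx hx' => simp only [map_add, add_lie, hx, hx']
  | ht a g =>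
  induction y using SmashLie.induction with
  | h0 => simp
  | ha x x' hx hx' => simp only [map_add, lie_add, hx, hx']
  | ht b h =>
    have e : F ⁅g, h⁆ = ⁅F g, F h⁆ := F.toLieHom.map_lie g h
    simp only [map_tmul, tmul_lie_tmul, map_add, map_sub, map_mul, F.apply_lie, e]

theorem map_smul' (F : LieRinehartAlgebra.Hom σ G H) (z : A ⊗[K] A) (x : SmashLie K A G) :
    map F (z • x) = Algebra.TensorProduct.map σ σ z • map F x := by
  induction x using SmashLie.induction with
  | h0 => simp
  | ha x x' hx hx' => simp only [map_add, smul_add, hx, hx']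
  | ht a g =>
  induction z with
  | zero => simp
  | add x x' hx hx' => simp only [map_add, add_smul, hx, hx']
  | tmul c d =>
    simp only [tmul_smul_tmul, map_tmul, Algebra.TensorProduct.map_tmul, map_mul,
      F.map_smul_apply]

theorem map_base_smul (F : LieRinehartAlgebra.Hom σ G H) (a : A) (x : SmashLie K A G) :
    map F (a • x) = σ a • map F x := by
  induction x using SmashLie.induction with
  | h0 => simp
  | ha x x' hx hx' => simp only [map_add, smul_add, hx, hx']
  | ht b g => simp only [smul_tmul', map_tmul, map_mul]

theorem map_lie_base (F : LieRinehartAlgebra.Hom σ G H) (x : SmashLie K A G) (a : A) :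
    σ ⁅x, a⁆ = ⁅map F x, σ a⁆ := by
  induction x using SmashLie.induction with
  | h0 => simp
  | ha x x' hx hx' => simp only [map_add, add_lie, hx, hx']
  | ht b g => simp only [tmul_lie, map_tmul, map_mul, F.apply_lie]

theorem map_mem_jetIdeal (F : LieRinehartAlgebra.Hom σ G H) (n : ℕ) (x : SmashLie K A G)
    (hx : x ∈ jetIdeal K A G n) : map F x ∈ jetIdeal K B H n := by
  have h1 : diagIdeal K A ≤ (diagIdeal K B).comap (Algebra.TensorProduct.map σ σ) := by
    intro z hz
    have key : Algebra.TensorProduct.lmul' K (S := B) (Algebra.TensorProduct.map σ σ z)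
        = σ (Algebra.TensorProduct.lmul' K (S := A) z) := by
      clear hz
      induction z with
      | zero => simp
      | add x x' hx hx' => simp only [map_add, hx, hx']
      | tmul c d => simp
    have hz' : Algebra.TensorProduct.lmul' K (S := A) z = 0 := hz
    change Algebra.TensorProduct.lmul' K (S := B) (Algebra.TensorProduct.map σ σ z) = 0
    rw [key, hz', map_zero]
  have hn : ∀ z ∈ diagIdeal K A ^ n, Algebra.TensorProduct.map σ σ z ∈ diagIdeal K B ^ n :=
    fun z hz => (Ideal.pow_right_mono h1 n).trans
      (Ideal.le_comap_pow (Algebra.TensorProduct.map σ σ) n) hz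
  induction hx using Submodule.smul_induction_on' with
  | smul z hz y _ =>
    rw [map_smul']; exact Submodule.smul_mem_smul (hn z hz) trivial
  | add y _ y' _ h h' => rw [map_add]; exact add_mem h h'

end SmashLie

namespace JetLie
open SmashLie

/-- The map induced by a morphism of Rinehart pairs on `(A # G) / J_n`. -/
def quotMap (F : LieRinehartAlgebra.Hom σ G H) (n : ℕ) :
    (SmashLie K A G ⧸ jetIdeal K A G n) → (SmashLie K B H ⧸ jetIdeal K B H n) :=
  Quotient.map (SmashLie.map F) <| by
    intro x y h
    have h' := (Submodule.quotientRel_def _).1 h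
    refine (Submodule.quotientRel_def _).2 ?_
    rw [← map_sub]; exact map_mem_jetIdeal F n _ h'

theorem quotMap_mk (F : LieRinehartAlgebra.Hom σ G H) (n : ℕ) (x : SmashLie K A G) :
    quotMap F n (Submodule.Quotient.mk x) = Submodule.Quotient.mk (SmashLie.map F x) := rfl

/-- The underlying function of `JetLie.map`. -/
def mapFun (F : LieRinehartAlgebra.Hom σ G H) (s : JetLie K A G) : JetLie K B H :=
  ⟨fun n => quotMap F n (s.val n), by
    intro m n hmn
    obtain ⟨x, hx⟩ := s.exists_rep n
    beta_reduce
    rw [hx n le_rfl, hx m hmn, quotMap_mk, quotMap_mk]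
    rfl⟩

theorem val_mapFun (F : LieRinehartAlgebra.Hom σ G H) {s : JetLie K A G} {n : ℕ}
    {x : SmashLie K A G} (hx : s.val n = Submodule.Quotient.mk x) :
    (mapFun F s).val n = Submodule.Quotient.mk (SmashLie.map F x) := by
  change quotMap F n (s.val n) = _
  rw [hx]; rfl

/-- The morphism of Rinehart pairs `(A, Ĵ(A, G)) → (B, Ĵ(B, H))` induced by a morphism
`(A, G) → (B, H)`. -/
def map (F : LieRinehartAlgebra.Hom σ G H) :
    LieRinehartAlgebra.Hom σ (JetLie K A G) (JetLie K B H) where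
  toFun := mapFun F
  map_add' s t := by
    refine ext fun n => ?_
    obtain ⟨x, hx⟩ := Submodule.Quotient.mk_surjective _ (s.val n)
    obtain ⟨y, hy⟩ := Submodule.Quotient.mk_surjective _ (t.val n)
    have h1 : (s + t).val n = Submodule.Quotient.mk (x + y) := by rw [val_add, ← hx, ← hy]; rfl
    rw [val_mapFun F h1, val_add, val_mapFun F hx.symm, val_mapFun F hy.symm, map_add]
    rfl
  map_smul' c s := by
    refine ext fun n => ?_
    obtain ⟨x, hx⟩ := Submodule.Quotient.mk_surjective _ (s.val n)
    have h1 : (c • s).val n = Submodule.Quotient.mk (c • x) := by rw [val_smul', ← hx]; rfl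
    rw [val_mapFun F h1, RingHom.id_apply, val_smul', val_mapFun F hx.symm, map_smul]
    rfl
  map_lie' {s t} := by
    refine ext fun n => ?_
    obtain ⟨x, hx⟩ := Submodule.Quotient.mk_surjective _ (s.val n)
    obtain ⟨y, hy⟩ := Submodule.Quotient.mk_surjective _ (t.val n)
    refine (val_mapFun F (val_lie hx.symm hy.symm)).trans ?_
    refine Eq.trans ?_ (val_lie (val_mapFun F hx.symm) (val_mapFun F hy.symm)).symm
    rw [SmashLie.map_lie]
  map_smul_apply' a s := by
    refine ext fun n => ?_
    obtain ⟨x, hx⟩ := Submodule.Quotient.mk_surjective _ (s.val n)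
    have h1 : (a • s).val n = Submodule.Quotient.mk (a • x) := by rw [val_smul, ← hx]; rfl
    refine (val_mapFun F h1).trans ?_
    rw [map_base_smul]
    change _ = σ a • (mapFun F s).val n
    rw [val_mapFun F hx.symm]
    rfl
  apply_lie' a s := by
    obtain ⟨x, hx⟩ := Submodule.Quotient.mk_surjective _ (s.val 1)
    rw [lie_base hx.symm, map_lie_base F]
    exact (lie_base (val_mapFun F hx.symm) (σ a)).symm

theorem val_map (F : LieRinehartAlgebra.Hom σ G H) {s : JetLie K A G} {n : ℕ}
    {x : SmashLie K A G} (hx : s.val n = Submodule.Quotient.mk x) :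
    (map F s).val n = Submodule.Quotient.mk (SmashLie.map F x) := val_mapFun F hx

theorem map_of (F : LieRinehartAlgebra.Hom σ G H) (x : SmashLie K A G) :
    map F (of x) = of (SmashLie.map F x) := rfl

theorem map_eq_self {σ : A →ₐ[K] A} (F : LieRinehartAlgebra.Hom σ G G) (hσ : ∀ a, σ a = a)
    (hF : ∀ g, F g = g) (s : JetLie K A G) : map F s = s := by
  have e : ∀ x, SmashLie.map F x = x := by
    intro x
    induction x using SmashLie.induction with
    | h0 => simp
    | ha x y hx hy => rw [map_add, hx, hy]
    | ht a g => rw [SmashLie.map_tmul, hσ, hF]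
  refine ext fun n => ?_
  obtain ⟨x, hx⟩ := Submodule.Quotient.mk_surjective _ (s.val n)
  rw [val_map F hx.symm, e, hx]

theorem map_map {ρ : A →ₐ[K] C} (F : LieRinehartAlgebra.Hom σ G H)
    (F' : LieRinehartAlgebra.Hom τ H L) (E : LieRinehartAlgebra.Hom ρ G L)
    (hρ : ∀ a, ρ a = τ (σ a)) (hE : ∀ g, E g = F' (F g)) (s : JetLie K A G) :
    map E s = map F' (map F s) := by
  have e : ∀ x, SmashLie.map E x = SmashLie.map F' (SmashLie.map F x) := by
    intro x
    induction x using SmashLie.induction with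
    | h0 => simp
    | ha x y hx hy => simp only [map_add, hx, hy]
    | ht a g => simp only [SmashLie.map_tmul, hρ, hE]
  refine ext fun n => ?_
  obtain ⟨x, hx⟩ := Submodule.Quotient.mk_surjective _ (s.val n)
  rw [val_map E hx.symm, val_map F' (val_map F hx.symm), e]

end JetLie

end Functoriality

section Enveloping
variable (K A G : Type*) [CommRing K] [CommRing A] [Algebra K A] [LieRing G] [LieAlgebra K G]
  [Module A G] [LieRingModule G A]

/-- The defining relations of the weak Rinehart enveloping algebra, in the tensor algebra of
`A ⊕ G`. -/
inductive WeakRel : TensorAlgebra K (A × G) → TensorAlgebra K (A × G) → Prop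
  | one : WeakRel (TensorAlgebra.ι K (1, 0)) 1
  | mul (a b : A) : WeakRel (TensorAlgebra.ι K (a, 0) * TensorAlgebra.ι K (b, 0))
      (TensorAlgebra.ι K (a * b, 0))
  | lie (g h : G) : WeakRel
      (TensorAlgebra.ι K (0, g) * TensorAlgebra.ι K (0, h)
        - TensorAlgebra.ι K (0, h) * TensorAlgebra.ι K (0, g))
      (TensorAlgebra.ι K (0, ⁅g, h⁆))
  | leibniz (g : G) (a : A) : WeakRel
      (TensorAlgebra.ι K (0, g) * TensorAlgebra.ι K (a, 0))
      (TensorAlgebra.ι K (a, 0) * TensorAlgebra.ι K (0, g) + TensorAlgebra.ι K (⁅g, a⁆, 0))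

/-- The weak Rinehart enveloping algebra `U(A, G) = A # 𝒰(G)`, presented by the generators
`A ⊕ G` and the relations that `A` is a unital subalgebra, that the commutator on `G` is the Lie
bracket, and `g · a = a · g + g(a)`. -/
def WeakEnv := RingQuot (WeakRel K A G)

namespace WeakEnv

instance : Ring (WeakEnv K A G) := inferInstanceAs (Ring (RingQuot (WeakRel K A G)))
instance : Algebra K (WeakEnv K A G) := inferInstanceAs (Algebra K (RingQuot (WeakRel K A G)))

/-- The quotient map from the tensor algebra. -/
def mk : TensorAlgebra K (A × G) →ₐ[K] WeakEnv K A G := RingQuot.mkAlgHom K (WeakRel K A G)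

variable {K A G} in
theorem mk_rel {x y : TensorAlgebra K (A × G)} (h : WeakRel K A G x y) :
    mk K A G x = mk K A G y := RingQuot.mkAlgHom_rel K h

/-- The map `A → U(A, G)`. -/
def ofBase : A →ₐ[K] WeakEnv K A G :=
  AlgHom.ofLinearMap ((mk K A G).toLinearMap ∘ₗ TensorAlgebra.ι K ∘ₗ LinearMap.inl K A G)
    ((mk_rel WeakRel.one).trans (map_one _))
    (fun a b => ((map_mul (mk K A G) _ _).symm.trans (mk_rel (WeakRel.mul a b))).symm)

/-- The map `G → U(A, G)`. -/
def ofLie : G →ₗ[K] WeakEnv K A G :=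
  (mk K A G).toLinearMap ∘ₗ TensorAlgebra.ι K ∘ₗ LinearMap.inr K A G

variable {K A G}

theorem mk_ι (a : A) (g : G) :
    mk K A G (TensorAlgebra.ι K (a, g)) = ofBase K A G a + ofLie K A G g := by
  change _ = mk K A G (TensorAlgebra.ι K (a, 0)) + mk K A G (TensorAlgebra.ι K (0, g))
  rw [← map_add, ← map_add]; simp

theorem ofLie_lie (g h : G) : ofLie K A G ⁅g, h⁆
    = ofLie K A G g * ofLie K A G h - ofLie K A G h * ofLie K A G g := by
  have := mk_rel (WeakRel.lie (K := K) (A := A) g h)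
  rw [map_sub, map_mul, map_mul] at this
  exact this.symm

theorem ofLie_mul_ofBase (g : G) (a : A) : ofLie K A G g * ofBase K A G a
    = ofBase K A G a * ofLie K A G g + ofBase K A G ⁅g, a⁆ := by
  have := mk_rel (WeakRel.leibniz (K := K) g a)
  rw [map_add, map_mul, map_mul] at this
  exact this

variable {R : Type*} [Ring R] [Algebra K R]

/-- The universal property of `U(A, G)`. -/
def lift (f : A →ₐ[K] R) (F : G →ₗ[K] R) (hl : ∀ g h, F ⁅g, h⁆ = F g * F h - F h * F g)
    (hr : ∀ g a, F g * f a = f a * F g + f ⁅g, a⁆) : WeakEnv K A G →ₐ[K] R :=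
  RingQuot.liftAlgHom K ⟨TensorAlgebra.lift K (LinearMap.coprod f.toLinearMap F), by
    intro x y h
    induction h with
    | one => simp
    | mul a b => simp
    | lie g h => simp [hl]
    | leibniz g a => simp [hr]⟩

theorem lift_mk (f : A →ₐ[K] R) (F : G →ₗ[K] R) (hl hr) (x : TensorAlgebra K (A × G)) :
    lift f F hl hr (mk K A G x) = TensorAlgebra.lift K (LinearMap.coprod f.toLinearMap F) x :=
  RingQuot.liftAlgHom_mkAlgHom_apply K _ _ x

theorem lift_ofBase (f : A →ₐ[K] R) (F : G →ₗ[K] R) (hl hr) (a : A) :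
    lift f F hl hr (ofBase K A G a) = f a := by
  refine (lift_mk f F hl hr (TensorAlgebra.ι K (a, 0))).trans ?_
  simp

theorem lift_ofLie (f : A →ₐ[K] R) (F : G →ₗ[K] R) (hl hr) (g : G) :
    lift f F hl hr (ofLie K A G g) = F g := by
  refine (lift_mk f F hl hr (TensorAlgebra.ι K (0, g))).trans ?_
  simp

theorem hom_ext {f g : WeakEnv K A G →ₐ[K] R} (h : ∀ a, f (ofBase K A G a) = g (ofBase K A G a))
    (h' : ∀ x, f (ofLie K A G x) = g (ofLie K A G x)) : f = g := by
  refine RingQuot.ringQuot_ext' K f g (TensorAlgebra.hom_ext (LinearMap.ext fun p => ?_))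
  obtain ⟨a, x⟩ := p
  change f (mk K A G (TensorAlgebra.ι K (a, x))) = g (mk K A G (TensorAlgebra.ι K (a, x)))
  rw [mk_ι, map_add, map_add, h, h']

end WeakEnv

/-- The relation `a · g = ag` defining `D(A, G)` as a quotient of `U(A, G)`. -/
inductive StrongRel : WeakEnv K A G → WeakEnv K A G → Prop
  | smul (a : A) (g : G) : StrongRel (WeakEnv.ofBase K A G a * WeakEnv.ofLie K A G g)
      (WeakEnv.ofLie K A G (a • g))

/-- The strong Rinehart enveloping algebra `D(A, G)`: the quotient of `U(A, G)` by the ideal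
generated by the elements `a · g - ag`. -/
def StrongEnv := RingQuot (StrongRel K A G)

namespace StrongEnv

instance : Ring (StrongEnv K A G) := inferInstanceAs (Ring (RingQuot (StrongRel K A G)))
instance : Algebra K (StrongEnv K A G) := inferInstanceAs (Algebra K (RingQuot (StrongRel K A G)))

/-- The quotient map `U(A, G) → D(A, G)`. -/
def mk : WeakEnv K A G →ₐ[K] StrongEnv K A G := RingQuot.mkAlgHom K (StrongRel K A G)

/-- The map `A → D(A, G)`. -/
def ofBase : A →ₐ[K] StrongEnv K A G := (mk K A G).comp (WeakEnv.ofBase K A G)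

/-- The map `G → D(A, G)`. -/
def ofLie : G →ₗ[K] StrongEnv K A G := (mk K A G).toLinearMap ∘ₗ WeakEnv.ofLie K A G

variable {K A G}

theorem ofLie_lie (g h : G) : ofLie K A G ⁅g, h⁆
    = ofLie K A G g * ofLie K A G h - ofLie K A G h * ofLie K A G g := by
  change mk K A G _ = mk K A G _ * mk K A G _ - mk K A G _ * mk K A G _
  rw [WeakEnv.ofLie_lie, map_sub, map_mul, map_mul]

theorem ofLie_mul_ofBase (g : G) (a : A) : ofLie K A G g * ofBase K A G a
    = ofBase K A G a * ofLie K A G g + ofBase K A G ⁅g, a⁆ := by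
  have := congrArg (mk K A G) (WeakEnv.ofLie_mul_ofBase (K := K) g a)
  rw [map_add, map_mul, map_mul] at this
  exact this

theorem ofLie_smul (a : A) (g : G) :
    ofLie K A G (a • g) = ofBase K A G a * ofLie K A G g := by
  change mk K A G _ = mk K A G _ * mk K A G _
  rw [← map_mul]
  exact (RingQuot.mkAlgHom_rel K (StrongRel.smul a g)).symm

variable {R : Type*} [Ring R] [Algebra K R]

/-- The universal property of `D(A, G)`. -/
def lift (f : A →ₐ[K] R) (F : G →ₗ[K] R) (hl : ∀ g h, F ⁅g, h⁆ = F g * F h - F h * F g)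
    (hr : ∀ g a, F g * f a = f a * F g + f ⁅g, a⁆) (hs : ∀ (a : A) (g : G), F (a • g) = f a * F g) :
    StrongEnv K A G →ₐ[K] R :=
  RingQuot.liftAlgHom K ⟨WeakEnv.lift f F hl hr, by
    intro x y h
    induction h with
    | smul a g => rw [map_mul, WeakEnv.lift_ofBase, WeakEnv.lift_ofLie, WeakEnv.lift_ofLie, hs]⟩

theorem lift_mk (f : A →ₐ[K] R) (F : G →ₗ[K] R) (hl hr hs) (x : WeakEnv K A G) :
    lift f F hl hr hs (mk K A G x) = WeakEnv.lift f F hl hr x :=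
  RingQuot.liftAlgHom_mkAlgHom_apply K _ _ x

theorem lift_ofBase (f : A →ₐ[K] R) (F : G →ₗ[K] R) (hl hr hs) (a : A) :
    lift f F hl hr hs (ofBase K A G a) = f a :=
  (lift_mk f F hl hr hs _).trans (WeakEnv.lift_ofBase f F hl hr a)

theorem lift_ofLie (f : A →ₐ[K] R) (F : G →ₗ[K] R) (hl hr hs) (g : G) :
    lift f F hl hr hs (ofLie K A G g) = F g :=
  (lift_mk f F hl hr hs _).trans (WeakEnv.lift_ofLie f F hl hr g)

theorem hom_ext {f g : StrongEnv K A G →ₐ[K] R}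
    (h : ∀ a, f (ofBase K A G a) = g (ofBase K A G a))
    (h' : ∀ x, f (ofLie K A G x) = g (ofLie K A G x)) : f = g :=
  RingQuot.ringQuot_ext' K f g (WeakEnv.hom_ext h h')

end StrongEnv
end Enveloping

section EnvMaps
variable {K A B G H : Type*} [CommRing K]
  [CommRing A] [Algebra K A] [LieRing G] [LieAlgebra K G] [Module A G] [LieRingModule G A]
  [CommRing B] [Algebra K B] [LieRing H] [LieAlgebra K H] [Module B H] [LieRingModule H B]
  {σ : A →ₐ[K] B}

/-- Functoriality of `U(A, G)`. -/
def WeakEnv.map (F : LieRinehartAlgebra.Hom σ G H) : WeakEnv K A G →ₐ[K] WeakEnv K B H :=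
  WeakEnv.lift ((WeakEnv.ofBase K B H).comp σ) (WeakEnv.ofLie K B H ∘ₗ F.toLieHom.toLinearMap)
    (fun g h => by
      change WeakEnv.ofLie K B H (F.toLieHom ⁅g, h⁆) = _
      rw [LieHom.map_lie, WeakEnv.ofLie_lie]; rfl)
    (fun g a => by
      change WeakEnv.ofLie K B H (F g) * WeakEnv.ofBase K B H (σ a)
        = _ + WeakEnv.ofBase K B H (σ ⁅g, a⁆)
      rw [WeakEnv.ofLie_mul_ofBase, F.apply_lie]; rfl)

theorem WeakEnv.map_ofBase (F : LieRinehartAlgebra.Hom σ G H) (a : A) :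
    WeakEnv.map F (WeakEnv.ofBase K A G a) = WeakEnv.ofBase K B H (σ a) :=
  WeakEnv.lift_ofBase _ _ _ _ a

theorem WeakEnv.map_ofLie (F : LieRinehartAlgebra.Hom σ G H) (g : G) :
    WeakEnv.map F (WeakEnv.ofLie K A G g) = WeakEnv.ofLie K B H (F g) :=
  WeakEnv.lift_ofLie _ _ _ _ g

/-- Functoriality of `D(A, G)`. -/
def StrongEnv.map (F : LieRinehartAlgebra.Hom σ G H) : StrongEnv K A G →ₐ[K] StrongEnv K B H :=
  StrongEnv.lift ((StrongEnv.ofBase K B H).comp σ)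
    (StrongEnv.ofLie K B H ∘ₗ F.toLieHom.toLinearMap)
    (fun g h => by
      change StrongEnv.ofLie K B H (F.toLieHom ⁅g, h⁆) = _
      rw [LieHom.map_lie, StrongEnv.ofLie_lie]; rfl)
    (fun g a => by
      change StrongEnv.ofLie K B H (F g) * StrongEnv.ofBase K B H (σ a)
        = _ + StrongEnv.ofBase K B H (σ ⁅g, a⁆)
      rw [StrongEnv.ofLie_mul_ofBase, F.apply_lie]; rfl)
    (fun a g => by
      change StrongEnv.ofLie K B H (F (a • g)) = _
      rw [F.map_smul_apply, StrongEnv.ofLie_smul]; rfl)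

theorem StrongEnv.map_ofBase (F : LieRinehartAlgebra.Hom σ G H) (a : A) :
    StrongEnv.map F (StrongEnv.ofBase K A G a) = StrongEnv.ofBase K B H (σ a) :=
  StrongEnv.lift_ofBase _ _ _ _ _ a

theorem StrongEnv.map_ofLie (F : LieRinehartAlgebra.Hom σ G H) (g : G) :
    StrongEnv.map F (StrongEnv.ofLie K A G g) = StrongEnv.ofLie K B H (F g) :=
  StrongEnv.lift_ofLie _ _ _ _ _ g

end EnvMaps

section Comparison
variable (K A G : Type*) [CommRing K] [CommRing A] [Algebra K A] [LieRing G] [LieAlgebra K G]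
  [Module A G] [LieRingModule G A] [LieRinehartRing A G] [LieRinehartAlgebra K A G]

/-- The map `G → Ĵ`, `g ↦ 1 # g`. -/
def JetLie.one : G →ₗ[K] JetLie K A G where
  toFun g := JetLie.of (SmashLie.tmul K 1 g)
  map_add' g h := by rw [SmashLie.tmul_add]; exact map_add (AdicCompletion.of _ _) _ _
  map_smul' c g := by
    have e : SmashLie.tmul K (1 : A) (c • g) = c • SmashLie.tmul K 1 g :=
      TensorProduct.tmul_smul c (1 : A) g
    rw [e]; rfl

/-- The canonical homomorphism `U(A, G) → D(A, Ĵ)`, `a ↦ a`, `g ↦ 1 # g`. -/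
def weakToStrong : WeakEnv K A G →ₐ[K] StrongEnv K A (JetLie K A G) :=
  WeakEnv.lift (StrongEnv.ofBase K A (JetLie K A G))
    (StrongEnv.ofLie K A (JetLie K A G) ∘ₗ JetLie.one K A G)
    (fun g h => by
      have e : JetLie.one K A G ⁅g, h⁆ = ⁅JetLie.one K A G g, JetLie.one K A G h⁆ := by
        refine JetLie.ext fun n => ?_
        refine Eq.trans ?_ (JetLie.val_lie (JetLie.val_of _ n) (JetLie.val_of _ n)).symm
        rw [SmashLie.tmul_lie_tmul]
        have z : ∀ g : G, ⁅g, (1 : A)⁆ = 0 := fun g =>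
          (LieRinehartAlgebra.anchor K A G g).map_one_eq_zero
        have z' : ∀ g : G, SmashLie.tmul K (0 : A) g = 0 := fun g => TensorProduct.zero_tmul _ g
        simp only [z, mul_zero, z', sub_zero, zero_add, mul_one]
        rfl
      simp only [LinearMap.comp_apply, e, StrongEnv.ofLie_lie])
    (fun g a => by
      have e : ⁅JetLie.one K A G g, a⁆ = ⁅g, a⁆ := by
        refine (JetLie.lie_base (JetLie.val_of _ 1) a).trans ?_
        rw [SmashLie.tmul_lie, one_mul]
      simp only [LinearMap.comp_apply, StrongEnv.ofLie_mul_ofBase, e])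

theorem weakToStrong_ofBase (a : A) :
    weakToStrong K A G (WeakEnv.ofBase K A G a) = StrongEnv.ofBase K A (JetLie K A G) a :=
  WeakEnv.lift_ofBase _ _ _ _ a

theorem weakToStrong_ofLie (g : G) : weakToStrong K A G (WeakEnv.ofLie K A G g)
    = StrongEnv.ofLie K A (JetLie K A G) (JetLie.one K A G g) :=
  WeakEnv.lift_ofLie _ _ _ _ g

end Comparison

section Derivations
variable {K A B : Type*} [CommRing K] [CommRing A] [Algebra K A] [CommRing B] [Algebra K B]

/-- Derivations extend uniquely along formally étale homomorphisms. -/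
theorem existsUnique_derivation_extension (σ : A →ₐ[K] B) (hσ : σ.toRingHom.FormallyEtale)
    (D : Derivation K A A) : ∃! D' : Derivation K B B, ∀ a, D' (σ a) = σ (D a) := by
  algebraize [σ.toRingHom]
  have : IsScalarTower K A B := IsScalarTower.of_algebraMap_eq' σ.comp_algebraMap.symm
  let e := KaehlerDifferential.tensorKaehlerEquivOfFormallyEtale K A B
  have he : ∀ a, e.symm (KaehlerDifferential.D K B (algebraMap A B a))
      = 1 ⊗ₜ KaehlerDifferential.D K A a :=
    KaehlerDifferential.tensorKaehlerEquivOfFormallyEtale_symm_D_algebraMap K A B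
  let l : B ⊗[A] Ω[A⁄K] →ₗ[B] B :=
    LinearMap.liftBaseChange B (Algebra.linearMap A B ∘ₗ D.liftKaehlerDifferential)
  refine ⟨(l ∘ₗ e.symm.toLinearMap).compDer (KaehlerDifferential.D K B), fun a => ?_, ?_⟩
  · change l (e.symm (KaehlerDifferential.D K B (algebraMap A B a))) = algebraMap A B (D a)
    rw [he]
    simp [l]
  · intro D' hD'
    have h : D'.liftKaehlerDifferential = l ∘ₗ e.symm.toLinearMap := by
      have h2 : D'.liftKaehlerDifferential ∘ₗ e.toLinearMap = l := by
        refine TensorProduct.AlgebraTensorModule.curry_injective ?_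
        ext x
        have h3 : e (1 ⊗ₜ KaehlerDifferential.D K A x)
            = KaehlerDifferential.D K B (algebraMap A B x) := by rw [← he, e.apply_symm_apply]
        change D'.liftKaehlerDifferential (e (1 ⊗ₜ KaehlerDifferential.D K A x))
          = l (1 ⊗ₜ KaehlerDifferential.D K A x)
        rw [h3]
        have h4 : D' (algebraMap A B x) = algebraMap A B (D x) := hD' x
        simp [l, h4]
      rw [← h2, LinearMap.comp_assoc]; ext; simp
    rw [← h]
    ext b; simp

/-- The extension of a derivation along a formally étale homomorphism. -/
def derivationExtension (σ : A →ₐ[K] B) (hσ : σ.toRingHom.FormallyEtale) (D : Derivation K A A) :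
    Derivation K B B := (existsUnique_derivation_extension σ hσ D).choose

theorem derivationExtension_apply (σ : A →ₐ[K] B) (hσ : σ.toRingHom.FormallyEtale)
    (D : Derivation K A A) (a : A) : derivationExtension σ hσ D (σ a) = σ (D a) :=
  (existsUnique_derivation_extension σ hσ D).choose_spec.1 a

theorem derivationExtension_unique (σ : A →ₐ[K] B) (hσ : σ.toRingHom.FormallyEtale)
    (D : Derivation K A A) (D' : Derivation K B B) (h : ∀ a, D' (σ a) = σ (D a)) :
    D' = derivationExtension σ hσ D :=
  (existsUnique_derivation_extension σ hσ D).choose_spec.2 D' h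

/-- The morphism of Rinehart pairs `(A, Der A) → (B, Der B)` attached to a formally étale
homomorphism `A → B`. -/
def derivationHom (σ : A →ₐ[K] B) (hσ : σ.toRingHom.FormallyEtale) :
    LieRinehartAlgebra.Hom σ (Derivation K A A) (Derivation K B B) where
  toFun := derivationExtension σ hσ
  map_add' D E := (derivationExtension_unique σ hσ _ _ fun a => by
    simp [derivationExtension_apply]).symm
  map_smul' c D := (derivationExtension_unique σ hσ _ _ fun a => by
    simp [derivationExtension_apply]).symm
  map_lie' {D E} := (derivationExtension_unique σ hσ _ _ fun a => by
    simp [derivationExtension_apply, Derivation.commutator_apply]).symm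
  map_smul_apply' a D := (derivationExtension_unique σ hσ _ _ fun b => by
    change (σ a • derivationExtension σ hσ D) (σ b) = _
    simp [derivationExtension_apply]).symm
  apply_lie' a D := (derivationExtension_apply σ hσ D a).symm

theorem derivationHom_apply (σ : A →ₐ[K] B) (hσ : σ.toRingHom.FormallyEtale)
    (D : Derivation K A A) (a : A) : derivationHom σ hσ D (σ a) = σ (D a) :=
  derivationExtension_apply σ hσ D a

theorem eq_derivationHom (σ : A →ₐ[K] B) (hσ : σ.toRingHom.FormallyEtale)
    (D : Derivation K A A) (D' : Derivation K B B) (h : ∀ a, D' (σ a) = σ (D a)) :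
    D' = derivationHom σ hσ D := derivationExtension_unique σ hσ D D' h

end Derivations
end

noncomputable section Schemes
open Opposite

variable (K : Type u) [Field K] (X : Scheme.{u}) [X.Over (Spec (CommRingCat.of K))]

/-- The `K`-algebra structure on the sections of the structure sheaf of a `K`-scheme. -/
instance sectionsAlgebra (U : X.Opens) : Algebra K Γ(X, U) :=
  RingHom.toAlgebra (((X ↘ Spec (CommRingCat.of K)).appLE ⊤ U le_top).hom.comp
    (Scheme.ΓSpecIso (CommRingCat.of K)).inv.hom)

variable {X} in
/-- The restriction homomorphism of sections. -/
def resAlgHom {U W : X.Opens} (h : W ≤ U) : Γ(X, U) →ₐ[K] Γ(X, W) where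
  __ := (X.presheaf.map (homOfLE h).op).hom
  commutes' k := by
    have := Scheme.Hom.appLE_map (X ↘ Spec (CommRingCat.of K)) (U := ⊤) le_top (homOfLE h).op
    exact congrArg (fun f => f.hom ((Scheme.ΓSpecIso (CommRingCat.of K)).inv.hom k)) this

variable {X} in
theorem resAlgHom_formallyEtale {U W : X.affineOpens} (h : W ≤ U) :
    (resAlgHom K (U := U.1) (W := W.1) h).toRingHom.FormallyEtale := by
  have h1 := (Scheme.Hom.etale_appLE (𝟙 X) U.2 W.2 h)
  have h2 : (𝟙 X : X ⟶ X).appLE U.1 W.1 h = X.presheaf.map (homOfLE h).op := by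
    simp only [Scheme.Hom.appLE, Scheme.Hom.id_app]
    exact Category.id_comp _
  rw [h2] at h1
  have h3 : @Algebra.Etale Γ(X, U.1) Γ(X, W.1) _ _ (X.presheaf.map (homOfLE h).op).hom.toAlgebra :=
    h1
  exact @Algebra.Etale.formallyEtale _ _ _ _ (_) h3

variable {X} in
/-- Vector fields on an affine open set `U`: `𝒱(U) = Der_K 𝒜(U)`. -/
abbrev VectorFields (U : X.affineOpens) : Type u := Derivation K Γ(X, U.1) Γ(X, U.1)

variable {X} in
/-- Restriction of vector fields. -/
def resVectorFields {U W : X.affineOpens} (h : W ≤ U) :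
    LieRinehartAlgebra.Hom (resAlgHom K (U := U.1) (W := W.1) h)
      (VectorFields K U) (VectorFields K W) :=
  derivationHom _ (resAlgHom_formallyEtale K h)

variable {X} in
theorem resVectorFields_id (U : X.affineOpens) (D : VectorFields K U) :
    resVectorFields K (le_refl U) D = D :=
  (eq_derivationHom _ (resAlgHom_formallyEtale K (le_refl U)) D D fun a => by
    have e : ∀ a : Γ(X, U.1), resAlgHom K (le_refl U.1) a = a := fun a =>
      congrArg (fun f => f.hom a) (X.presheaf.map_id (op U.1))
    exact (congrArg D (e a)).trans (e (D a)).symm).symm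

variable {X} in
theorem resAlgHom_id (U : X.Opens) (a : Γ(X, U)) : resAlgHom K (le_refl U) a = a :=
  congrArg (fun f => f.hom a) (X.presheaf.map_id (op U))

variable {X} in
theorem resAlgHom_comp {U V W : X.Opens} (h : V ≤ U) (h' : W ≤ V) (a : Γ(X, U)) :
    resAlgHom K (h'.trans h) a = resAlgHom K h' (resAlgHom K h a) :=
  congrArg (fun f => f.hom a) ((congrArg X.presheaf.map (Subsingleton.elim _ _)).trans
    (X.presheaf.map_comp (homOfLE h).op (homOfLE h').op))

variable {X} in
theorem resVectorFields_comp {U V W : X.affineOpens} (h : V ≤ U) (h' : W ≤ V)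
    (D : VectorFields K U) :
    resVectorFields K (h'.trans h) D = resVectorFields K h' (resVectorFields K h D) := by
  refine (eq_derivationHom _ (resAlgHom_formallyEtale K (h'.trans h)) D _ fun a => ?_).symm
  rw [resAlgHom_comp K h h', resAlgHom_comp K h h']
  exact (derivationHom_apply _ (resAlgHom_formallyEtale K h') _ _).trans
    (congrArg _ (derivationHom_apply _ (resAlgHom_formallyEtale K h) _ _))

/-- The structure sheaf `𝒜` on the affine open sets. -/
def affineStructureSheaf : X.affineOpensᵒᵖ ⥤ RingCat.{u} where
  obj U := RingCat.of Γ(X, U.unop.1)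
  map f := RingCat.ofHom (X.presheaf.map (homOfLE (leOfHom f.unop)).op).hom
  map_id U := by
    ext a
    exact congrArg (fun f => f.hom a) (X.presheaf.map_id (op U.unop.1))
  map_comp {U V W} f g := by
    ext a
    exact congrArg (fun f => f.hom a) ((congrArg X.presheaf.map (Subsingleton.elim _ _)).trans
      (X.presheaf.map_comp (homOfLE (leOfHom f.unop) : _ ⟶ U.unop.1).op
        (homOfLE (leOfHom g.unop) : _ ⟶ V.unop.1).op))

/-- The sheaf of algebras `U(𝒜, 𝒱)` on the affine open sets, `U ↦ 𝒜(U) # 𝒰(𝒱(U))`. -/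
def weakAlgebra : X.affineOpensᵒᵖ ⥤ RingCat.{u} where
  obj U := RingCat.of (WeakEnv K Γ(X, U.unop.1) (VectorFields K U.unop))
  map f := RingCat.ofHom (WeakEnv.map (resVectorFields K (leOfHom f.unop))).toRingHom
  map_id U := by
    ext x
    refine DFunLike.congr_fun (WeakEnv.hom_ext (g := AlgHom.id K _) (fun a => ?_) fun D => ?_) x
    · exact (WeakEnv.map_ofBase _ a).trans (congrArg _ (resAlgHom_id K U.unop.1 a))
    · exact (WeakEnv.map_ofLie _ D).trans (congrArg _ (resVectorFields_id K U.unop D))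
  map_comp {U V W} f g := by
    ext x
    refine DFunLike.congr_fun (WeakEnv.hom_ext
      (f := WeakEnv.map (resVectorFields K (leOfHom (f ≫ g).unop)))
      (g := (WeakEnv.map (resVectorFields K (leOfHom g.unop))).comp
        (WeakEnv.map (resVectorFields K (leOfHom f.unop)))) (fun a => ?_) fun D => ?_) x
    · simp only [AlgHom.comp_apply, WeakEnv.map_ofBase]
      exact congrArg _ (resAlgHom_comp K (leOfHom f.unop) (leOfHom g.unop) a)
    · simp only [AlgHom.comp_apply, WeakEnv.map_ofLie]
      exact congrArg _ (resVectorFields_comp K (leOfHom f.unop) (leOfHom g.unop) D)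

variable {X} in
/-- Jets of vector fields on an affine open set, `𝒥̂(U) = lim_n (A # V) / (Δⁿ ⊗_A V)` with
`A = 𝒜(U)` and `V = 𝒱(U)`. -/
abbrev VectorFieldJets (U : X.affineOpens) : Type u :=
  JetLie K Γ(X, U.1) (VectorFields K U)

variable {X} in
/-- Restriction of jets of vector fields. -/
def resJets {U W : X.affineOpens} (h : W ≤ U) :
    LieRinehartAlgebra.Hom (resAlgHom K (U := U.1) (W := W.1) h)
      (VectorFieldJets K U) (VectorFieldJets K W) :=
  JetLie.map (resVectorFields K h)

/-- The sheaf of algebras `D(𝒜, 𝒥̂)` on the affine open sets. -/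
def strongAlgebra : X.affineOpensᵒᵖ ⥤ RingCat.{u} where
  obj U := RingCat.of (StrongEnv K Γ(X, U.unop.1) (VectorFieldJets K U.unop))
  map f := RingCat.ofHom (StrongEnv.map (resJets K (leOfHom f.unop))).toRingHom
  map_id U := by
    ext x
    refine DFunLike.congr_fun (StrongEnv.hom_ext (g := AlgHom.id K _) (fun a => ?_) fun s => ?_) x
    · exact (StrongEnv.map_ofBase _ a).trans (congrArg _ (resAlgHom_id K U.unop.1 a))
    · exact (StrongEnv.map_ofLie _ s).trans (congrArg _
        (JetLie.map_eq_self _ (resAlgHom_id K U.unop.1) (resVectorFields_id K U.unop) s))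
  map_comp {U V W} f g := by
    ext x
    refine DFunLike.congr_fun (StrongEnv.hom_ext
      (f := StrongEnv.map (resJets K (leOfHom (f ≫ g).unop)))
      (g := (StrongEnv.map (resJets K (leOfHom g.unop))).comp
        (StrongEnv.map (resJets K (leOfHom f.unop)))) (fun a => ?_) fun s => ?_) x
    · simp only [AlgHom.comp_apply, StrongEnv.map_ofBase]
      exact congrArg _ (resAlgHom_comp K (leOfHom f.unop) (leOfHom g.unop) a)
    · simp only [AlgHom.comp_apply, StrongEnv.map_ofLie]
      exact congrArg _ (JetLie.map_map _ _ _
        (resAlgHom_comp K (leOfHom f.unop) (leOfHom g.unop))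
        (resVectorFields_comp K (leOfHom f.unop) (leOfHom g.unop)) s)

/-- The inclusion `𝒜 → U(𝒜, 𝒱)`. -/
def baseToWeak : affineStructureSheaf X ⟶ weakAlgebra K X where
  app U := RingCat.ofHom (WeakEnv.ofBase K Γ(X, U.unop.1) (VectorFields K U.unop)).toRingHom
  naturality U W f := by
    ext a
    exact (WeakEnv.map_ofBase (resVectorFields K (leOfHom f.unop)) a).symm

/-- The inclusion `𝒜 → D(𝒜, 𝒥̂)`. -/
def baseToStrong : affineStructureSheaf X ⟶ strongAlgebra K X where
  app U := RingCat.ofHom (StrongEnv.ofBase K Γ(X, U.unop.1) (VectorFieldJets K U.unop)).toRingHom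
  naturality U W f := by
    ext a
    exact (StrongEnv.map_ofBase (resJets K (leOfHom f.unop)) a).symm

/-- The canonical homomorphism `U(𝒜, 𝒱) → D(𝒜, 𝒥̂)`, `f ↦ f`, `η ↦ 1 # η`. -/
def weakToStrongAlgebra : weakAlgebra K X ⟶ strongAlgebra K X where
  app U := RingCat.ofHom (weakToStrong K Γ(X, U.unop.1) (VectorFields K U.unop)).toRingHom
  naturality U W f := by
    ext x
    refine DFunLike.congr_fun (WeakEnv.hom_ext
      (f := (weakToStrong K Γ(X, W.unop.1) (VectorFields K W.unop)).comp
        (WeakEnv.map (resVectorFields K (leOfHom f.unop))))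
      (g := (StrongEnv.map (resJets K (leOfHom f.unop))).comp
        (weakToStrong K Γ(X, U.unop.1) (VectorFields K U.unop))) (fun a => ?_) fun D => ?_) x
    · simp only [AlgHom.comp_apply, WeakEnv.map_ofBase, weakToStrong_ofBase, StrongEnv.map_ofBase]
    · simp only [AlgHom.comp_apply, WeakEnv.map_ofLie, weakToStrong_ofLie, StrongEnv.map_ofLie]
      refine congrArg _ ?_
      refine Eq.trans ?_ (JetLie.map_of _ _).symm
      rw [SmashLie.map_tmul, map_one]
      rfl

theorem baseToWeak_comp : baseToWeak K X ≫ weakToStrongAlgebra K X = baseToStrong K X := by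
  ext U a
  exact weakToStrong_ofBase K Γ(X, U.unop.1) (VectorFields K U.unop) a

variable {X} in
/-- The `𝒜(U)`-module structure on the sections of an `𝒜`-module over an affine open set `U`. -/
instance (M : PresheafOfModules.{u} (affineStructureSheaf X)) (U : X.affineOpens) :
    Module Γ(X, U.1) (M.obj (op U)) := (M.obj (op U)).isModule

variable {X} in
/-- The restriction `𝒜(U) → 𝒜(W)`. -/
def resFunctions {U W : X.affineOpens} (h : W ≤ U) : Γ(X, U.1) →+* Γ(X, W.1) :=
  (X.presheaf.map (homOfLE h : W.1 ⟶ U.1).op).hom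

variable {X} in
/-- The restriction `M(U) → M(W)` of an `𝒜`-module. -/
def resSections (M : PresheafOfModules.{u} (affineStructureSheaf X)) {U W : X.affineOpens}
    (h : W ≤ U) : M.obj (op U) →+ M.obj (op W) :=
  (M.map (homOfLE h).op).hom.toAddMonoidHom

variable {X} in
/-- An `𝒜`-module, given on the affine open sets, is a finitely generated quasi-coherent sheaf:
each `M(U)` is finitely generated over `𝒜(U)`, and `M(U_f)` is the localization `M(U)_f` (note that
`f` is invertible on `U_f`). -/
structure IsFinitelyGeneratedSheaf (M : PresheafOfModules.{u} (affineStructureSheaf X)) :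
    Prop where
  finite (U : X.affineOpens) : Module.Finite Γ(X, U.1) (M.obj (op U))
  exists_pow_smul_eq (U : X.affineOpens) (f : Γ(X, U.1)) (m : M.obj (op (X.affineBasicOpen f))) :
    ∃ (n : ℕ) (m' : M.obj (op U)),
      resFunctions (X.affineBasicOpen_le f) f ^ n • m
        = resSections M (X.affineBasicOpen_le f) m'
  pow_smul_eq_zero (U : X.affineOpens) (f : Γ(X, U.1)) (m : M.obj (op U)) :
    resSections M (X.affineBasicOpen_le f) m = 0 → ∃ n : ℕ, f ^ n • m = 0

/-- `weak_fin 𝒱`: finitely generated `𝒜`-modules with a compatible action of `𝒱`, that is,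
modules over `U(𝒜, 𝒱)` whose underlying `𝒜`-module is finitely generated. -/
abbrev WeakFin : Type _ :=
  ObjectProperty.FullSubcategory (C := PresheafOfModules.{u} (weakAlgebra K X)) fun M =>
    IsFinitelyGeneratedSheaf ((PresheafOfModules.restrictScalars (baseToWeak K X)).obj M)

/-- `strong_fin 𝒥̂`: modules over `D(𝒜, 𝒥̂)` whose underlying `𝒜`-module is finitely
generated. -/
abbrev StrongFin : Type _ :=
  ObjectProperty.FullSubcategory (C := PresheafOfModules.{u} (strongAlgebra K X)) fun M =>
    IsFinitelyGeneratedSheaf ((PresheafOfModules.restrictScalars (baseToStrong K X)).obj M)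

/-- Restriction of scalars along `U(𝒜, 𝒱) → D(𝒜, 𝒥̂)`. -/
def strongToWeak : StrongFin K X ⥤ WeakFin K X :=
  ObjectProperty.lift _ (ObjectProperty.ι _ ⋙
    PresheafOfModules.restrictScalars (weakToStrongAlgebra K X)) fun M => by
      have key : ∀ N : PresheafOfModules.{u} (strongAlgebra K X),
          IsFinitelyGeneratedSheaf ((PresheafOfModules.restrictScalars (baseToStrong K X)).obj N) →
          IsFinitelyGeneratedSheaf ((PresheafOfModules.restrictScalars (baseToWeak K X)).obj
            ((PresheafOfModules.restrictScalars (weakToStrongAlgebra K X)).obj N)) := by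
        intro N h
        rw [← baseToWeak_comp] at h
        exact h
      exact key M.obj M.property

end Schemes

/-! Over an affine open set with functions `A` and vector fields `V`, the map `a # g ↦ a · g` is a
Lie homomorphism `A # V → U(A, V)`, so a weak `V`-module carries an action of `A # V`. To turn it
into a module over `D(A, Ĵ)` one only needs this action to factor through some `(A # V) / J_N`: a
jet then acts through any representative of sufficiently high order, and the relation `a · s = as`
holds by construction. Conversely, if jets vanishing to high order act by zero on two `D(A,
Ĵ)`-modules, a `U(A, V)`-linear map between them is `D(A, Ĵ)`-linear, because every jet agrees with
an element of `A # V` up to a term acting by zero. So everything rests on one fact: on a finitely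
generated module, jets of high order act by zero.

Nilpotency (`exists_pow_smul_eq_zero`). Let `g(a) = 1`, put `t = 1 ⊗ a - a ⊗ 1 ∈ Δ` and `v = 1 # g`.
Elements of `Δ ⊗ V` have zero anchor, hence act `A`-linearly. Since `[t v, t^(j+1) v] = j t^(j+1)
v`, the operators `t^(j+1) v` are eigenvectors of a commutator in the Noetherian module `End_A M`,
with distinct eigenvalues; in characteristic zero, and with `M` torsion-free, almost all of them
vanish. Brackets with these carry the vanishing from `t^j v` to `t^j s` for every `s`, and brackets
with `e v`, `e ∈ Δ`, replace the factors `t` by arbitrary elements of `Δ`.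

Torsion-freeness (`HasCoordinates.isTorsionFree`). The annihilator of the torsion of `M` is a
nonzero ideal stable under all derivations. An Euler field at a closed point forces a proper stable
ideal into all powers of the maximal ideal, hence to be zero by Krull; so the annihilator is `A` and
there is no torsion.

Globally, a smooth scheme has local coordinates. As the sections are torsion-free on an integral
scheme, a bound on one nonempty basic open subset of `U` holds on all of `U`. -/

/-! ### Nilpotency of the action of high-order vector fields -/

section Nilpotency

variable {A M : Type*} [CommRing A] [IsDomain A] [CharZero A] [AddCommGroup M] [Module A M]
  [Module.IsTorsionFree A M]

/-- On a finite torsion-free module over a Noetherian domain of characteristic zero, the commutator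
with a fixed endomorphism has only finitely many natural numbers as eigenvalues. -/
theorem Module.End.exists_forall_eq_zero_of_commutator_eq [IsNoetherianRing A] [Module.Finite A M]
    (E : Module.End A M) (f : ℕ → Module.End A M)
    (h : ∀ k, E * f k - f k * E = k • f k) : ∃ n, ∀ k ≥ n, f k = 0 := by
  let c : Module.End A (Module.End A M) := LinearMap.mulLeft A E - LinearMap.mulRight A E
  have hc : ∀ k, c (f k) = (k : A) • f k := fun k => by
    rw [Nat.cast_smul_eq_nsmul, ← h k]; rfl
  let s : Set ℕ := {k | f k ≠ 0}
  -- The nonzero `f k` are eigenvectors of the commutator with `E` for distinct eigenvalues `k`,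
  -- hence independent; a Noetherian module has room for only finitely many.
  have hli : LinearIndependent A fun k : s => f k :=
    c.eigenvectors_linearIndependent' (fun k : s => ((k : ℕ) : A))
      (Nat.cast_injective.comp Subtype.val_injective) _
      fun k => ⟨Module.End.mem_eigenspace_iff.2 (hc k), k.2⟩
  have : IsNoetherian A (Module.End A M) := isNoetherian_linearMap A M M
  have hs : s.Finite := hli.finite_of_isNoetherian
  obtain ⟨n, hn⟩ := hs.bddAbove
  refine ⟨n + 1, fun k hk => ?_⟩
  by_contra hne
  have : k ≤ n := hn hne
  omega

variable {k R L : Type*} [CommRing k] [CommRing R] [Algebra k R] [LieRing L] [Module R L]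

variable (A) in
/-- A Lie algebra `L` of vector fields containing a vector field `v` for which there is a function
`t` in the ideal `Δ` with `v(t) = 1` acts on a finite torsion-free module through
`L / Δᴺ L` for some `N`, as soon as `Δ L` acts linearly. -/
theorem exists_pow_smul_eq_zero [IsNoetherianRing A] [Module.Finite A M]
    (Δ : Ideal R) (D : Derivation k R R) (t : R) (ht : t ∈ Δ) (hDt : D t = 1) (v : L)
    (φ : L → L) (Q : R → L →ₗ[R] L)
    (hQpow : ∀ n s, Q (t ^ (n + 1)) s = (n + 1) • t ^ n • Q t s)
    (hQQ : ∀ s, Q t (Q t s) = Q t s) (hQv : Q t v = v) (hφv : φ v = 0)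
    (hlie : ∀ e ∈ Δ, ∀ z ∈ Δ, ∀ s, ⁅e • v, z • s⁆ = (e * D z) • s + (z * e) • φ s - z • Q e s)
    (ρ : L →+ AddMonoid.End M) (hρ : ∀ x y, ρ ⁅x, y⁆ = ρ x * ρ y - ρ y * ρ x)
    (hA : ∀ z ∈ Δ, ∀ s (a : A) m, ρ (z • s) (a • m) = a • ρ (z • s) m) :
    ∃ N, ∀ z ∈ Δ ^ N, ∀ s, ρ (z • s) = 0 := by
  have hdiv : ∀ (n : ℕ) (x : L), n ≠ 0 → ρ (n • x) = 0 → ρ x = 0 := by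
    intro n x hn h
    ext m
    have h1 := DFunLike.congr_fun h m
    rw [map_nsmul] at h1
    change n • ρ x m = 0 at h1
    rw [← Nat.cast_smul_eq_nsmul A] at h1
    exact (smul_eq_zero.1 h1).resolve_left (Nat.cast_ne_zero.2 hn)
  have hid : ∀ x y, ρ y = 0 → ρ ⁅x, y⁆ = 0 := fun x y hy => by
    rw [hρ, hy, mul_zero, zero_mul, sub_zero]
  have hid' : ∀ x y, ρ x = 0 → ρ ⁅x, y⁆ = 0 := fun x y hy => by
    rw [hρ, hy, mul_zero, zero_mul, sub_zero]
  have hΔpow : ∀ n, n ≠ 0 → t ^ n ∈ Δ := fun n hn =>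
    Ideal.pow_mem_of_mem _ ht n (Nat.pos_of_ne_zero hn)
  have hDpow : ∀ n, D (t ^ (n + 1)) = (n + 1 : ℕ) * t ^ n := fun n => by
    rw [D.leibniz_pow, hDt]; simp
  -- large powers of `t` times `v` act by zero
  have h1 : ∃ n, ∀ j ≥ n, ρ (t ^ (j + 1) • v) = 0 := by
    let f : ℕ → Module.End A M := fun j =>
      { toFun := ρ (t ^ (j + 1) • v)
        map_add' := map_add _
        map_smul' := hA _ (hΔpow _ (by omega)) v }
    obtain ⟨n, hn⟩ := Module.End.exists_forall_eq_zero_of_commutator_eq (f 0) f (fun j => by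
      -- `t v` plays the role of an Euler field. The exponents start at one because `v` itself need
      -- not act linearly; only `Δ L` does.
      have e : ⁅t ^ (0 + 1) • v, t ^ (j + 1) • v⁆ = j • t ^ (j + 1) • v := by
        rw [hlie _ (hΔpow _ (by omega)) _ (hΔpow _ (by omega)), hφv, hDpow, zero_add, pow_one, hQv]
        simp only [smul_zero, add_zero, ← Nat.cast_smul_eq_nsmul R, smul_smul, ← sub_smul]
        congr 1
        push_cast
        ring
      have e2 := hρ (t ^ (0 + 1) • v) (t ^ (j + 1) • v)
      rw [e, map_nsmul] at e2
      ext m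
      exact (DFunLike.congr_fun e2 m).symm)
    refine ⟨n, fun j hj => ?_⟩
    ext m
    exact LinearMap.congr_fun (hn j hj) m
  obtain ⟨n, hn⟩ := h1
  -- Requiring the vanishing for all `s` makes this an ideal, since a factor `c` can be moved onto
  -- `s`.
  let J : Ideal R :=
    { carrier := {z | ∀ s, ρ (z • s) = 0}
      zero_mem' := fun s => by simp
      add_mem' := fun {a b} ha hb s => by rw [add_smul, map_add, ha, hb, add_zero]
      smul_mem' := fun c z hz s => by rw [smul_assoc, smul_comm]; exact hz _ }
  have h2 : t ^ (n + 2) ∈ J := by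
    -- The brackets `[t^(n+1) v, t² s]` and `[t^(n+2) v, t s]` both act by zero and both contain
    -- `t^(n+3) φ s`. The unknown `φ s` cancels in their difference.
    have key : ∀ s, ρ (t ^ (n + 2) • (s + Q t s)) = 0 := by
      intro s
      have h1 := hid' (t ^ (n + 1) • v) (t ^ 2 • s) (hn n le_rfl)
      have h2 := hid' (t ^ (n + 2) • v) (t ^ 1 • s) (hn (n + 1) (by omega))
      rw [hlie _ (hΔpow _ (by omega)) _ (hΔpow _ (by omega)), hQpow, hDpow] at h1 h2
      have h3 := congrArg₂ (· - ·) h1 h2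
      simp only [← map_sub, sub_zero] at h3
      rw [← h3]
      congr 1
      simp only [smul_add, ← Nat.cast_smul_eq_nsmul R, smul_smul]
      push_cast
      module
    intro s
    -- On the image of the idempotent `Q t` the identity `key` becomes `2 t^(n+2) Q t s = 0`, and
    -- `2` may be divided out.
    have e1 : ρ (t ^ (n + 2) • Q t s) = 0 := by
      refine hdiv 2 _ two_ne_zero ?_
      have := key (Q t s)
      rwa [hQQ, smul_add, ← two_nsmul] at this
    have e2 := key s
    rwa [smul_add, map_add, e1, add_zero] at e2
  -- `D` lowers the `Δ`-adic order by at most one, and the factor `e` makes up for it.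
  have hDΔ : ∀ i, ∀ e ∈ Δ, ∀ z ∈ Δ ^ i, e * D z ∈ Δ ^ i := by
    intro i e he
    induction i with
    | zero => simp
    | succ i ih =>
      intro z hz
      rw [pow_succ] at hz ⊢
      induction hz using Submodule.mul_induction_on' with
      | mem_mul_mem x hx y hy =>
        rw [D.leibniz, smul_eq_mul, smul_eq_mul, mul_add, mul_left_comm, mul_left_comm e y,
          mul_comm y]
        exact add_mem (Ideal.mul_mem_mul hx (Ideal.mul_mem_right _ _ he))
          (Ideal.mul_mem_mul (ih x hx) hy)
      | add x _ y _ hx hy => rw [map_add, mul_add]; exact add_mem hx hy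
  -- The factors of `t^(n+2)` are traded one at a time for arbitrary elements of `Δ`.
  have h3 : ∀ i ≤ n + 2, ∀ z ∈ Δ ^ i, z * t ^ (n + 2 - i) ∈ J := by
    intro i
    induction i with
    | zero => exact fun _ z _ => J.mul_mem_left z h2
    | succ i ih =>
      intro hi z hz
      obtain ⟨q, hq⟩ : ∃ q, q = n + 2 - (i + 1) := ⟨_, rfl⟩
      have hq' : n + 2 - i = q + 1 := by omega
      rw [← hq]
      rw [hq'] at ih
      replace ih := ih (by omega)
      rw [pow_succ] at hz
      induction hz using Submodule.mul_induction_on' with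
      | add x _ y _ hx hy => rw [add_mul]; exact add_mem hx hy
      | mem_mul_mem z hz e he =>
      intro s
      have hz' := ih z hz
      -- In `[e v, z t^(q+1) s]` the terms with `φ` and `Q e` have a coefficient `z t^(q+1)` in `J`,
      -- and `e D(z) t^(q+1)` lies in `J` by `hDΔ` and the induction hypothesis. What remains is
      -- `(q+1) z e t^q s`.
      have h4 := hid (e • v) _ (hz' s)
      rw [hlie e he _ (Ideal.mul_mem_left _ _ (hΔpow _ (by omega))), map_sub, map_add, hz', sub_zero,
        mul_smul _ e, hz', add_zero, D.leibniz, hDpow, smul_eq_mul, smul_eq_mul, mul_add, add_smul,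
        map_add, mul_left_comm e _ (D z), mul_comm (t ^ _), ih _ (hDΔ i e he z hz), add_zero] at h4
      refine hdiv (q + 1) _ (by omega) ?_
      rw [← h4, ← Nat.cast_smul_eq_nsmul R, smul_smul]
      congr 2
      ring
  refine ⟨n + 2, fun z hz => ?_⟩
  have := h3 (n + 2) le_rfl z hz
  rw [Nat.sub_self, pow_zero, mul_one] at this
  exact this

end Nilpotency

/-! ### Brackets in `Δ ⊗ V` and in its completion -/

noncomputable section
section JetIdentities
variable {K A G : Type*} [CommRing K] [CommRing A] [Algebra K A] [LieRing G] [LieAlgebra K G]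
  [Module A G] [LieRingModule G A] [LieRinehartRing A G] [LieRinehartAlgebra K A G]

namespace SmashLie

variable (K A) in
/-- The derivation of `A ⊗ A` given by the action of `g ∈ G` on the second factor. -/
def rightDerivation (g : G) : Derivation K (A ⊗[K] A) (A ⊗[K] A) :=
  Derivation.mk' (LinearMap.lTensor A (LieModule.toEnd K G A g)) fun z w => by
    induction z with
    | zero => simp
    | add x x' hx hx' => simp only [add_mul, map_add, hx, hx', add_smul, smul_add]; abel
    | tmul c d =>
    induction w with
    | zero => simp
    | add x x' hx hx' => simp only [mul_add, map_add, hx, hx', add_smul, smul_add]; abel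
    | tmul c' d' =>
      simp [TensorProduct.tmul_add, mul_comm]

theorem rightDerivation_tmul (g : G) (c d : A) :
    rightDerivation K A g (c ⊗ₜ d) = c ⊗ₜ ⁅g, d⁆ := rfl

theorem rightDerivation_smul (a : A) (g : G) (z : A ⊗[K] A) :
    rightDerivation K A (a • g) z = (1 ⊗ₜ a) * rightDerivation K A g z := by
  induction z with
  | zero => simp
  | add x x' hx hx' => simp only [map_add, hx, hx', mul_add]
  | tmul c d => simp [rightDerivation_tmul]

theorem rightDerivation_add (g h : G) (z : A ⊗[K] A) :
    rightDerivation K A (g + h) z = rightDerivation K A g z + rightDerivation K A h z := by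
  induction z with
  | zero => simp
  | add x x' hx hx' => simp only [map_add, hx, hx']; abel
  | tmul c d => simp [rightDerivation_tmul, TensorProduct.tmul_add]

/-- By the Leibniz rule at most one factor from `Δ` is lost. This is why operators built from `[g,
·]` need their input to one order more than their output. -/
theorem rightDerivation_mem_pow (g : G) (n : ℕ) :
    ∀ z ∈ diagIdeal K A ^ (n + 1), rightDerivation K A g z ∈ diagIdeal K A ^ n := by
  induction n with
  | zero => simp
  | succ n ih =>
    intro z hz
    rw [pow_succ] at hz
    induction hz using Submodule.mul_induction_on' with
    | add x _ y _ hx hy => rw [map_add]; exact add_mem hx hy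
    | mem_mul_mem x hx y hy =>
      rw [Derivation.leibniz]
      refine add_mem (Ideal.mul_mem_right _ _ hx) ?_
      rw [smul_eq_mul, mul_comm, pow_succ]
      exact Ideal.mul_mem_mul (ih x hx) hy

/-- The action of `A # G` on `A ⊗ A` through the second factor, linear over `A ⊗ A`:
`(a # g) e = (a ⊗ 1) (id ⊗ g)(e)`. -/
def rightAction (e : A ⊗[K] A) : SmashLie K A G →ₗ[A ⊗[K] A] A ⊗[K] A :=
  let f : (A ⊗[K] G) →ₗ[K] A ⊗[K] A := TensorProduct.lift <| LinearMap.mk₂ K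
    (fun a g => (a ⊗ₜ 1) * rightDerivation K A g e)
    (fun a b g => by rw [TensorProduct.add_tmul, add_mul])
    (fun c a g => by rw [← TensorProduct.smul_tmul', smul_mul_assoc])
    (fun a g h => by rw [rightDerivation_add, mul_add])
    (fun c a g => by
      rw [← algebraMap_smul A c g, rightDerivation_smul, ← mul_assoc, mul_comm (a ⊗ₜ[K] 1),
        mul_assoc, Algebra.TensorProduct.tmul_one_eq_one_tmul c |>.symm,
        ← Algebra.TensorProduct.algebraMap_apply, ← Algebra.smul_def])
  { toFun := f
    map_add' := map_add f
    map_smul' := fun z x => by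
      have ht : ∀ (a : A) (g : G), f (a ⊗ₜ g) = (a ⊗ₜ 1) * rightDerivation K A g e :=
        fun _ _ => rfl
      have ha : ∀ x y : SmashLie K A G, f (x + y) = f x + f y := map_add f
      rw [RingHom.id_apply, smul_eq_mul]
      induction x using SmashLie.induction with
      | h0 =>
        rw [smul_zero]
        exact (map_zero f).trans ((congrArg (z * ·) (map_zero f)).trans (mul_zero z)).symm
      | ha x x' hx hx' => rw [smul_add, ha, ha, hx, hx', mul_add]
      | ht b g =>
      induction z with
      | zero => rw [zero_smul, zero_mul]; exact map_zero f
      | add x x' hx hx' => rw [add_smul, ha, hx, hx', add_mul]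
      | tmul c d =>
        refine (ht (c * b) (d • g)).trans ?_
        refine Eq.trans ?_ (congrArg ((c ⊗ₜ[K] d) * ·) (ht b g)).symm
        rw [rightDerivation_smul, ← mul_assoc, ← mul_assoc]
        simp }

theorem rightAction_tmul (e : A ⊗[K] A) (a : A) (g : G) :
    rightAction e (tmul K a g) = (a ⊗ₜ 1) * rightDerivation K A g e := rfl

theorem rightAction_pow (t : A ⊗[K] A) (n : ℕ) (x : SmashLie K A G) :
    rightAction (t ^ (n + 1)) x = (n + 1) • (t ^ n * rightAction t x) := by
  induction x using SmashLie.induction with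
  | h0 => simp
  | ha x y hx hy => rw [map_add, map_add, hx, hy, mul_add, smul_add]
  | ht a g =>
    simp only [rightAction_tmul, Derivation.leibniz_pow, Nat.add_sub_cancel, smul_eq_mul,
      nsmul_eq_mul]
    ring

/-- The operator `x ↦ x(e) (1 # g)` on `A # G`. -/
def contract (g : G) (e : A ⊗[K] A) : SmashLie K A G →ₗ[A ⊗[K] A] SmashLie K A G :=
  (LinearMap.toSpanSingleton (A ⊗[K] A) _ (tmul K 1 g)) ∘ₗ rightAction e

theorem contract_apply (g : G) (e : A ⊗[K] A) (x : SmashLie K A G) :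
    contract g e x = rightAction e x • tmul K 1 g := rfl

theorem contract_pow (g : G) (t : A ⊗[K] A) (n : ℕ) (x : SmashLie K A G) :
    contract g (t ^ (n + 1)) x = (n + 1) • t ^ n • contract g t x := by
  rw [contract_apply, contract_apply, rightAction_pow, smul_assoc, mul_smul]

theorem contract_tmul_one (g : G) (t : A ⊗[K] A) (ht : rightDerivation K A g t = 1) :
    contract g t (tmul K 1 g) = tmul K 1 g := by
  rw [contract_apply, rightAction_tmul, ht, mul_one]; exact one_smul _ _

/-- When `t` is a coordinate along `g`, the operator `contract g t` is a projection onto the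
multiples of `1 # g`. -/
theorem contract_contract (g : G) (t : A ⊗[K] A) (ht : rightDerivation K A g t = 1)
    (x : SmashLie K A G) : contract g t (contract g t x) = contract g t x := by
  rw [contract_apply g t x, map_smul, contract_tmul_one g t ht]

/-- The operator `a # h ↦ a # [g, h]` on `A # G`. -/
def rightBracket (g : G) : SmashLie K A G →ₗ[K] SmashLie K A G :=
  LinearMap.lTensor A (LieModule.toEnd K G G g)

theorem rightBracket_tmul (g : G) (a : A) (h : G) :
    rightBracket g (tmul K a h) = tmul K a ⁅g, h⁆ := rfl

theorem rightBracket_smul (g : G) (z : A ⊗[K] A) (x : SmashLie K A G) :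
    rightBracket g (z • x) = rightDerivation K A g z • x + z • rightBracket g x := by
  induction x using SmashLie.induction with
  | h0 => simp
  | ha x y hx hy => simp only [smul_add, map_add, hx, hy]; abel
  | ht a h =>
  induction z with
  | zero => simp
  | add x y hx hy => simp only [add_smul, map_add, hx, hy]; abel
  | tmul c d =>
    simp only [tmul_smul_tmul, rightBracket_tmul, rightDerivation_tmul,
      LieRinehartRing.leibniz_smul_right, tmul_add]
    abel

theorem rightBracket_mem_jetIdeal (g : G) (n : ℕ) (x : SmashLie K A G)
    (hx : x ∈ jetIdeal K A G (n + 1)) : rightBracket g x ∈ jetIdeal K A G n := by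
  induction hx using Submodule.smul_induction_on' with
  | smul z hz y _ =>
    rw [rightBracket_smul]
    exact add_mem (Submodule.smul_mem_smul (rightDerivation_mem_pow g n z hz) trivial)
      (Submodule.smul_mem_smul (Ideal.pow_le_pow_right (Nat.le_succ n) hz) trivial)
  | add y _ y' _ h h' => rw [map_add]; exact add_mem h h'

/-- Elements of `Δ ⊗ V` have zero anchor, so they bracket like vector fields along the second
factor, with functions of the first factor as constants. This is the usual rule `[e g, z x] = e g(z)
x + z e [g, x] - z x(e) g`. -/
theorem smul_lie_smul (g : G) {e z : A ⊗[K] A} (he : e ∈ diagIdeal K A) (hz : z ∈ diagIdeal K A)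
    (x : SmashLie K A G) : ⁅e • tmul K (1 : A) g, z • x⁆
      = (e * rightDerivation K A g z) • x + (z * e) • rightBracket g x - z • contract g e x := by
  -- the bracket of arbitrary elements has two more terms, which come from the anchors
  have key : ∀ (e z : A ⊗[K] A) (h : G), ⁅e • tmul K (1 : A) g, z • tmul K (1 : A) h⁆
      = (e * rightDerivation K A g z) • tmul K 1 h + (z * e) • tmul K 1 ⁅g, h⁆
        - (z * rightDerivation K A h e) • tmul K 1 g
        + Algebra.TensorProduct.lmul' K (S := A) e •
          LinearMap.rTensor A (LieModule.toEnd K G A g) z • tmul K (1 : A) h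
        - Algebra.TensorProduct.lmul' K (S := A) z •
          LinearMap.rTensor A (LieModule.toEnd K G A h) e • tmul K (1 : A) g := by
    intro e z h
    induction e with
    | zero => simp
    | add x y hx hy =>
      simp only [add_smul, add_lie, hx, hy, map_add, mul_add, add_mul, smul_add]; abel
    | tmul c d =>
    induction z with
    | zero => simp
    | add x y hx hy =>
      simp only [add_smul, lie_add, hx, hy, map_add, mul_add, add_mul, smul_add]; abel
    | tmul c' d' =>
      have hd : ⁅d • g, h⁆ = d • ⁅g, h⁆ - ⁅h, d⁆ • g := by
        rw [← lie_skew, LieRinehartRing.leibniz_smul_right, ← lie_skew h g, smul_neg]; abel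
      simp only [tmul_smul_tmul, mul_one, tmul_lie_tmul, rightDerivation_tmul,
        Algebra.TensorProduct.tmul_mul_tmul, LinearMap.rTensor_tmul, LieModule.toEnd_apply_apply,
        Algebra.TensorProduct.lmul'_apply_tmul, smul_tmul', LieRinehartRing.lie_smul_eq_mul,
        LieRinehartRing.leibniz_smul_right, tmul_add, tmul_sub, hd, smul_sub, smul_smul, mul_comm,
        mul_left_comm]
      abel
  induction x using SmashLie.induction with
  | h0 => simp
  | ha x y hx hy => simp only [smul_add, lie_add, hx, hy, map_add]; abel
  | ht b h =>
    have h1 : Algebra.TensorProduct.lmul' K (S := A) e = 0 := he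
    -- As `b # h = (b ⊗ 1)(1 # h)` and `b ⊗ 1` is a constant for derivations of the second factor,
    -- `b` is absorbed into `z` without leaving `Δ`.
    have h2 : Algebra.TensorProduct.lmul' K (S := A) (z * b ⊗ₜ 1) = 0 :=
      Ideal.mul_mem_right (b ⊗ₜ 1) (diagIdeal K A) hz
    have h3 : ∀ g : G, tmul K b g = (b ⊗ₜ[K] (1 : A)) • tmul K 1 g := fun g => by
      rw [tmul_smul_tmul, mul_one, one_smul]
    have h4 : rightDerivation K A g (b ⊗ₜ 1) = 0 := by
      rw [rightDerivation_tmul, show ⁅g, (1 : A)⁆ = 0 from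
        (LieRinehartAlgebra.anchor K A G g).map_one_eq_zero,
        TensorProduct.tmul_zero]
    rw [contract_apply, rightAction_tmul, rightBracket_tmul, h3, h3, ← mul_smul, key, h1, h2,
      Derivation.leibniz, h4]
    simp only [zero_smul, add_zero, sub_zero, ← mul_smul, smul_eq_mul, mul_zero, zero_add]
    exact congrArg₂ _ (congrArg₂ _ (congrArg (· • tmul K (1 : A) h) (by ring))
      (congrArg (· • tmul K (1 : A) ⁅g, h⁆) (by ring)))
      (congrArg (· • tmul K (1 : A) g) (by ring))

end SmashLie

namespace JetLie
open SmashLie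

theorem val_smul_tensor (z : A ⊗[K] A) (s : JetLie K A G) (n : ℕ) :
    (z • s).val n = z • s.val n := rfl

theorem val_sub (s t : JetLie K A G) (n : ℕ) : (s - t).val n = s.val n - t.val n := rfl

/-- The underlying function of `JetLie.contract`. -/
def contractFun (g : G) (e : A ⊗[K] A) (s : JetLie K A G) : JetLie K A G :=
  AdicCompletion.map (diagIdeal K A) (SmashLie.contract g e) s

theorem val_contractFun (g : G) (e : A ⊗[K] A) {s : JetLie K A G} {n : ℕ} {x : SmashLie K A G}
    (hx : s.val n = Submodule.Quotient.mk x) :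
    (contractFun g e s).val n = Submodule.Quotient.mk (SmashLie.contract g e x) :=
  (AdicCompletion.map_val_apply (diagIdeal K A) (SmashLie.contract g e) s).trans
    ((congrArg _ hx).trans rfl)

/-- The operator `s ↦ s(e) (1 # g)` on jets. -/
def contract (g : G) (e : A ⊗[K] A) : JetLie K A G →ₗ[A ⊗[K] A] JetLie K A G where
  toFun := contractFun g e
  map_add' s t := ext fun n => by
    obtain ⟨x, hx⟩ := s.exists_rep n
    obtain ⟨y, hy⟩ := t.exists_rep n
    have h : (s + t).val n = Submodule.Quotient.mk (x + y) := by
      rw [val_add, hx n le_rfl, hy n le_rfl, Submodule.Quotient.mk_add]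
    rw [val_contractFun g e h, val_add, val_contractFun g e (hx n le_rfl),
      val_contractFun g e (hy n le_rfl), map_add, Submodule.Quotient.mk_add]
  map_smul' c s := ext fun n => by
    obtain ⟨x, hx⟩ := s.exists_rep n
    have h : (c • s).val n = Submodule.Quotient.mk (c • x) := by
      rw [val_smul_tensor, hx n le_rfl, Submodule.Quotient.mk_smul]
    rw [val_contractFun g e h, RingHom.id_apply, val_smul_tensor, val_contractFun g e (hx n le_rfl),
      map_smul, Submodule.Quotient.mk_smul]

theorem val_contract (g : G) (e : A ⊗[K] A) {s : JetLie K A G} {n : ℕ} {x : SmashLie K A G}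
    (hx : s.val n = Submodule.Quotient.mk x) :
    (contract g e s).val n = Submodule.Quotient.mk (SmashLie.contract g e x) :=
  val_contractFun g e hx

/-- `rightBracket g` is not linear over `A ⊗ A`, so it does not descend to each quotient by `J_n`.
But it maps `J_(n+1)` into `J_n`, so to order `n` it depends only on the jet to order `n + 1`. -/
theorem exists_eq_mk_rightBracket (g : G) (s : JetLie K A G) (n : ℕ) :
    ∃ y : SmashLie K A G ⧸ jetIdeal K A G n, ∀ x, s.val (n + 1) = Submodule.Quotient.mk x →
      y = Submodule.Quotient.mk (SmashLie.rightBracket g x) := by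
  obtain ⟨x, hx⟩ := s.exists_rep (n + 1)
  refine ⟨Submodule.Quotient.mk (SmashLie.rightBracket g x), fun x' hx' => ?_⟩
  rw [hx _ le_rfl, Submodule.Quotient.eq] at hx'
  rw [Submodule.Quotient.eq, ← map_sub]
  exact rightBracket_mem_jetIdeal g n _ hx'

/-- The operator on jets that extends `a # h ↦ a # [g, h]`. -/
def rightBracket (g : G) (s : JetLie K A G) : JetLie K A G :=
  ⟨fun n => (exists_eq_mk_rightBracket g s n).choose, fun {m n} hmn => by
    obtain ⟨x, hx⟩ := s.exists_rep (n + 1)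
    beta_reduce
    rw [(exists_eq_mk_rightBracket g s n).choose_spec x (hx _ le_rfl),
      (exists_eq_mk_rightBracket g s m).choose_spec x (hx _ (by omega))]
    rfl⟩

theorem val_rightBracket (g : G) {s : JetLie K A G} {n : ℕ} {x : SmashLie K A G}
    (hx : s.val (n + 1) = Submodule.Quotient.mk x) :
    (rightBracket g s).val n = Submodule.Quotient.mk (SmashLie.rightBracket g x) :=
  (exists_eq_mk_rightBracket g s n).choose_spec x hx

theorem val_one (g : G) (n : ℕ) :
    (one K A G g).val n = Submodule.Quotient.mk (tmul K 1 g) := rfl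

theorem smul_lie_smul (g : G) {e z : A ⊗[K] A} (he : e ∈ diagIdeal K A) (hz : z ∈ diagIdeal K A)
    (s : JetLie K A G) : ⁅e • one K A G g, z • s⁆
      = (e * rightDerivation K A g z) • s + (z * e) • rightBracket g s - z • contract g e s := by
  refine ext fun n => ?_
  obtain ⟨x, hx⟩ := s.exists_rep (n + 1)
  have h0 : ∀ c : A ⊗[K] A, (c • s).val n = Submodule.Quotient.mk (c • x) := fun c => by
    rw [val_smul_tensor, hx n (by omega), Submodule.Quotient.mk_smul]
  have h1 : (e • one K A G g).val n = Submodule.Quotient.mk (e • tmul K (1 : A) g) := by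
    rw [val_smul_tensor, val_one, Submodule.Quotient.mk_smul]
  rw [val_lie h1 (h0 z), SmashLie.smul_lie_smul g he hz, val_sub, val_add, val_smul_tensor (z * e),
    val_smul_tensor z, h0, val_rightBracket g (hx _ le_rfl), val_contract g e (hx n (by omega)),
    Submodule.Quotient.mk_sub, Submodule.Quotient.mk_add, Submodule.Quotient.mk_smul _ (z * e),
    Submodule.Quotient.mk_smul _ z]

end JetLie

variable {M : Type*} [IsDomain A] [CharZero A] [IsNoetherianRing A] [AddCommGroup M] [Module A M]
  [Module.IsTorsionFree A M] [Module.Finite A M]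
open SmashLie

/-- If some vector field `g` and some function `a` satisfy `g(a) = 1`, then `A # G` acts on a finite
torsion-free module through some quotient `(A # G) / J_N`. -/
theorem SmashLie.exists_forall_mem_jetIdeal (g : G) (a : A) (hga : ⁅g, a⁆ = 1)
    (ρ : SmashLie K A G →+ AddMonoid.End M) (hρ : ∀ x y, ρ ⁅x, y⁆ = ρ x * ρ y - ρ y * ρ x)
    (hA : ∀ x (b : A) m, ρ x (b • m) = b • ρ x m + ⁅x, b⁆ • m) :
    ∃ N, ∀ x ∈ jetIdeal K A G N, ρ x = 0 := by
  have hg1 : ⁅g, (1 : A)⁆ = 0 := (LieRinehartAlgebra.anchor K A G g).map_one_eq_zero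
  -- This is the coordinate `t`: it vanishes on the diagonal, and `a ⊗ 1` is a constant for the
  -- second factor.
  have hD : rightDerivation K A g (1 ⊗ₜ a - a ⊗ₜ 1) = 1 := by
    rw [map_sub, rightDerivation_tmul, rightDerivation_tmul, hga, hg1]; simp; rfl
  obtain ⟨N, hN⟩ := exists_pow_smul_eq_zero A (diagIdeal K A) (rightDerivation K A g)
    (1 ⊗ₜ a - a ⊗ₜ 1) (KaehlerDifferential.one_smul_sub_smul_one_mem_ideal K a) hD (tmul K 1 g)
    (rightBracket g) (contract g) (fun n s => contract_pow g _ n s)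
    (contract_contract g _ hD) (contract_tmul_one g _ hD)
    (by rw [rightBracket_tmul, lie_self]; exact TensorProduct.tmul_zero _ _)
    (fun e he z hz s => smul_lie_smul g he hz s) ρ hρ (fun z hz s b m => by
      -- The anchor of `z • s` vanishes for `z ∈ Δ`, so the Leibniz rule becomes `A`-linearity.
      rw [hA, lie_base_eq_zero, zero_smul, add_zero]
      exact Submodule.smul_mem_smul (by rwa [pow_one]) trivial)
  refine ⟨N, fun x hx => ?_⟩
  induction hx using Submodule.smul_induction_on' with
  | smul z hz y _ => exact hN z hz y
  | add y _ y' _ h h' => rw [map_add, h, h', add_zero]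

/-- If some vector field `g` and some function `a` satisfy `g(a) = 1`, then `Ĵ` acts on a finite
torsion-free module through some quotient `(A # G) / J_N`. -/
theorem JetLie.exists_forall_val_eq_zero (hfg : (diagIdeal K A).FG) (g : G) (a : A)
    (hga : ⁅g, a⁆ = 1)
    (ρ : JetLie K A G →+ AddMonoid.End M) (hρ : ∀ x y, ρ ⁅x, y⁆ = ρ x * ρ y - ρ y * ρ x)
    (hA : ∀ x (b : A) m, ρ x (b • m) = b • ρ x m + ⁅x, b⁆ • m) :
    ∃ N, ∀ s : JetLie K A G, s.val N = 0 → ρ s = 0 := by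
  have hg1 : ⁅g, (1 : A)⁆ = 0 := (LieRinehartAlgebra.anchor K A G g).map_one_eq_zero
  have hD : rightDerivation K A g (1 ⊗ₜ a - a ⊗ₜ 1) = 1 := by
    rw [map_sub, rightDerivation_tmul, rightDerivation_tmul, hga, hg1]; simp; rfl
  obtain ⟨N, hN⟩ := exists_pow_smul_eq_zero A (diagIdeal K A) (rightDerivation K A g)
    (1 ⊗ₜ a - a ⊗ₜ 1) (KaehlerDifferential.one_smul_sub_smul_one_mem_ideal K a) hD (one K A G g)
    (rightBracket g) (contract g)
    (fun n s => ext fun k => by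
      obtain ⟨x, hx⟩ := s.exists_rep k
      rw [val_contract g _ (hx k le_rfl), SmashLie.contract_pow]
      change _ = (n + 1) • (1 ⊗ₜ[K] a - a ⊗ₜ[K] 1) ^ n • (contract g _ s).val k
      rw [val_contract g _ (hx k le_rfl)]; rfl)
    (fun s => ext fun k => by
      obtain ⟨x, hx⟩ := s.exists_rep k
      rw [val_contract g _ (val_contract g _ (hx k le_rfl)), val_contract g _ (hx k le_rfl),
        SmashLie.contract_contract g _ hD])
    (ext fun k => by
      rw [val_contract g _ (val_one _ _), SmashLie.contract_tmul_one g _ hD]; rfl)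
    (ext fun k => by
      rw [val_rightBracket g (val_one _ _), SmashLie.rightBracket_tmul, lie_self]
      exact congrArg _ (TensorProduct.tmul_zero _ _))
    (fun e he z hz s => smul_lie_smul g he hz s) ρ hρ (fun z hz s b m => by
      rw [hA]
      obtain ⟨x, hx⟩ := s.exists_rep 1
      have h0 : (z • s).val 1 = Submodule.Quotient.mk (z • x) := by
        rw [val_smul_tensor, hx 1 le_rfl]; rfl
      rw [lie_base h0, lie_base_eq_zero, zero_smul, add_zero]
      exact Submodule.smul_mem_smul (by rwa [pow_one]) trivial)
  refine ⟨N, fun s hs => ?_⟩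
  -- Since `Δ` is finitely generated, the jets vanishing to order `N` are exactly `Δᴺ Ĵ`, so each is
  -- a finite sum of elements that are known to act by zero.
  have hs' : s ∈ (diagIdeal K A ^ N • ⊤ :
      Submodule (A ⊗[K] A) (AdicCompletion (diagIdeal K A) (SmashLie K A G))) := by
    rw [AdicCompletion.pow_smul_top_eq_ker_eval hfg]; exact hs
  clear hs
  induction hs' using Submodule.smul_induction_on' with
  | smul z hz y _ => exact hN z hz y
  | add y _ y' _ h h' => exact (map_add ρ y y').trans (by rw [h, h', add_zero])

end JetIdentities
end

/-! ### Coordinates, Euler fields and torsion-freeness -/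

section Coordinates

/-- A derivation that maps a ring to an ideal `I` and is the identity on `I / I²` acts on
`Iⁿ / Iⁿ⁺¹` as multiplication by `n`. -/
theorem Derivation.apply_sub_nsmul_mem_pow {k R : Type*} [CommRing k] [CommRing R] [Algebra k R]
    (E : Derivation k R R) (I : Ideal R) (hI : ∀ a, E a ∈ I) (h : ∀ a ∈ I, E a - a ∈ I ^ 2)
    (n : ℕ) : ∀ a ∈ I ^ n, E a - n • a ∈ I ^ (n + 1) := by
  induction n with
  | zero => simpa using hI
  | succ n ih =>
    intro a ha
    rw [pow_succ] at ha
    induction ha using Submodule.mul_induction_on' with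
    | mem_mul_mem x hx y hy =>
      have e : E (x * y) - (n + 1) • (x * y) = x * (E y - y) + (E x - n • x) * y := by
        rw [E.leibniz]; simp only [smul_eq_mul, nsmul_eq_mul]; push_cast; ring
      rw [e]
      refine add_mem ?_ ?_
      · rw [show n + 1 + 1 = n + 2 from rfl, pow_add]; exact Ideal.mul_mem_mul hx (h y hy)
      · rw [pow_succ]; exact Ideal.mul_mem_mul (ih x hx) hy
    | add x _ y _ hx hy =>
      rw [map_add, smul_add, add_sub_add_comm]; exact add_mem hx hy

open KaehlerDifferential in
/-- The Kähler differentials of `A` have a basis of exact differentials. -/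
def HasCoordinates (K A : Type*) [CommRing K] [CommRing A] [Algebra K A] : Prop :=
  ∃ (ι : Type) (b : Module.Basis ι A (Ω[A⁄K])), Set.range b ⊆ Set.range (D K A)

variable {K A : Type*} [Field K] [CommRing A] [Algebra K A]

/-- A member `da` of the basis has a dual derivation `D`, with `D(a) = 1`. If the basis is empty
there are no differentials, hence no nonzero derivations. -/
theorem HasCoordinates.subsingleton_or_exists (h : HasCoordinates K A) :
    Subsingleton (Derivation K A A) ∨ ∃ (D : Derivation K A A) (a : A), ⁅D, a⁆ = 1 := by
  obtain ⟨ι, b, hb⟩ := h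
  rcases isEmpty_or_nonempty ι with hι | ⟨⟨i⟩⟩
  · left
    have := b.repr.toEquiv.subsingleton
    refine ⟨fun D E => ?_⟩
    rw [← D.liftKaehlerDifferential_comp, ← E.liftKaehlerDifferential_comp,
      Subsingleton.elim D.liftKaehlerDifferential E.liftKaehlerDifferential]
  · right
    obtain ⟨a, ha⟩ := hb ⟨i, rfl⟩
    refine ⟨(b.coord i).compDer (KaehlerDifferential.D K A), a, ?_⟩
    change b.coord i (KaehlerDifferential.D K A a) = 1
    simp [ha]

/-- In a domain with coordinates, of finite type over an algebraically closed field of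
characteristic zero, no proper nonzero ideal is stable under all derivations. -/
theorem HasCoordinates.eq_top_of_stable [IsAlgClosed K] [CharZero K] [IsDomain A]
    [Algebra.FiniteType K A] (h : HasCoordinates K A) (I : Ideal A)
    (hI : ∀ (D : Derivation K A A), ∀ a ∈ I, D a ∈ I) (hne : I ≠ ⊥) : I = ⊤ := by
  by_contra htop
  obtain ⟨n, hn, hIn⟩ := I.exists_le_maximal htop
  obtain ⟨ι, b, hb⟩ := h
  choose x hx using fun i => hb ⟨i, rfl⟩
  have : Finite ι := Module.Finite.finite_basis b
  have := Fintype.ofFinite ι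
  have : IsNoetherianRing A := Algebra.FiniteType.isNoetherianRing K A
  let _ := Ideal.Quotient.field n
  -- By the Nullstellensatz the residue field is `K`; `c` below is evaluation at the closed point of
  -- `n`.
  have : Module.Finite K (A ⧸ n) := finite_of_finite_type_of_isJacobsonRing K (A ⧸ n)
  let e := AlgEquiv.ofBijective (Algebra.ofId K (A ⧸ n))
    (IsAlgClosed.algebraMap_bijective_of_isIntegral (k := K) (K := A ⧸ n))
  let c : A →ₐ[K] K := e.symm.toAlgHom.comp (Ideal.Quotient.mkₐ K n)
  have hc : ∀ a, a - algebraMap K A (c a) ∈ n := fun a => by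
    rw [← Ideal.Quotient.eq]
    exact (e.apply_symm_apply (Ideal.Quotient.mk n a)).symm
  have hc0 : ∀ a ∈ n, c a = 0 := fun a ha => by
    change e.symm (Ideal.Quotient.mk n a) = 0
    rw [Ideal.Quotient.eq_zero_iff_mem.2 ha, map_zero]
  -- The coordinates are centred at the point, and `E = ∑ yᵢ ∂ᵢ` is the Euler field there.
  let y : ι → A := fun i => x i - algebraMap K A (c (x i))
  let E : Derivation K A A := ∑ i, y i • (b.coord i).compDer (KaehlerDifferential.D K A)
  have hE : ∀ a, E a = ∑ i, b.repr (KaehlerDifferential.D K A a) i * y i := fun a => by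
    have h1 : E a = ∑ i, (y i • (b.coord i).compDer (KaehlerDifferential.D K A)) a :=
      (congrFun (map_sum (Derivation.coeFnAddMonoidHom (R := K) (A := A) (M := A)) _ _)
        a).trans (Finset.sum_apply _ _ _)
    rw [h1]
    exact Finset.sum_congr rfl fun i _ => mul_comm _ _
  -- Modulo `n²` the map `a ↦ a - c(a)` is a derivation, because `(a - c(a))(a' - c(a'))` lies in
  -- `n²`. It agrees with `E` on the `xᵢ`, whose differentials form a basis, hence everywhere; so
  -- `E` is the identity on `n / n²`.
  let δ : Derivation K A (A ⧸ n ^ 2) := Derivation.mk'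
    ((Ideal.Quotient.mkₐ K (n ^ 2)).toLinearMap ∘ₗ
      (LinearMap.id - Algebra.linearMap K A ∘ₗ c.toLinearMap)) fun a a' => by
    change Ideal.Quotient.mk _ (a * a' - algebraMap K A (c (a * a')))
      = Ideal.Quotient.mk _ (a * (a' - algebraMap K A (c a')))
        + Ideal.Quotient.mk _ (a' * (a - algebraMap K A (c a)))
    rw [← map_add, Ideal.Quotient.eq, map_mul, map_mul, ← neg_mem_iff, pow_two]
    convert! Ideal.mul_mem_mul (hc a) (hc a') using 1
    ring
  have hδ : ∀ a, δ a = Ideal.Quotient.mk _ (E a) := fun a => by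
    rw [← δ.liftKaehlerDifferential_comp_D, ← b.sum_repr (KaehlerDifferential.D K A a), map_sum, hE,
      map_sum]
    refine Finset.sum_congr rfl fun i _ => ?_
    rw [map_smul, ← hx, δ.liftKaehlerDifferential_comp_D]
    rfl
  have hE1 : ∀ a, E a ∈ n := fun a => by
    rw [hE]; exact sum_mem fun i _ => n.mul_mem_left _ (hc _)
  have hE2 : ∀ a ∈ n, E a - a ∈ n ^ 2 := fun a ha => by
    rw [← Ideal.Quotient.eq, ← hδ]
    change Ideal.Quotient.mk _ (a - algebraMap K A (c a)) = _
    rw [hc0 a ha, map_zero, sub_zero]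
  -- For `a ∈ I ⊆ n^(k+1)` stability puts `∂ᵢ a` in `n^(k+1)`, so `E a ∈ n^(k+2)`. But `E a` is
  -- `(k+1) a` modulo `n^(k+2)`, and `k + 1` is invertible in `K`.
  have hpow : ∀ k, I ≤ n ^ (k + 1) := by
    intro k
    induction k with
    | zero => simpa using hIn
    | succ k ih =>
      intro a ha
      have h1 := E.apply_sub_nsmul_mem_pow n hE1 hE2 (k + 1) a (ih ha)
      have h2 : E a ∈ n ^ (k + 1 + 1) := by
        rw [hE, pow_succ']
        refine sum_mem fun i _ => ?_
        rw [mul_comm (b.repr _ i)]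
        exact Ideal.mul_mem_mul (hc _)
          (ih (hI ((b.coord i).compDer (KaehlerDifferential.D K A)) a ha))
      have h3 := sub_mem h2 h1
      rw [sub_sub_cancel, ← Nat.cast_smul_eq_nsmul K] at h3
      have h4 := (n ^ (k + 1 + 1)).smul_of_tower_mem (((k + 1 : ℕ) : K)⁻¹) h3
      rwa [inv_smul_smul₀ (by exact_mod_cast Nat.succ_ne_zero k)] at h4
  refine hne (le_bot_iff.1 ?_)
  rw [← Ideal.iInf_pow_eq_bot_of_isDomain n hn.ne_top]
  exact le_iInf fun k => (hpow k).trans (Ideal.pow_le_pow_right (Nat.le_succ k))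

/-- A finite module with a compatible action of all derivations is torsion-free. -/
theorem HasCoordinates.isTorsionFree [IsAlgClosed K] [CharZero K] [IsDomain A]
    [Algebra.FiniteType K A] (h : HasCoordinates K A) {M : Type*} [AddCommGroup M] [Module A M]
    [Module.Finite A M] (η : Derivation K A A → M → M)
    (hη : ∀ D (a : A) m, η D (a • m) = a • η D m + D a • m) (hη0 : ∀ D, η D 0 = 0) :
    Module.IsTorsionFree A M := by
  have : IsNoetherianRing A := Algebra.FiniteType.isNoetherianRing K A
  let T := Submodule.torsion A M
  -- The torsion submodule is finitely generated, so a single non-zero-divisor kills all of it.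
  obtain ⟨a, ha, ha'⟩ := Submodule.annihilator_top_inter_nonZeroDivisors
    (Submodule.torsion_isTorsion (R := A) (M := M))
  have hT : ∀ a : A, a ∈ (⊤ : Submodule A T).annihilator ↔ ∀ m ∈ T, a • m = 0 := fun a => by
    rw [Submodule.mem_annihilator]
    exact ⟨fun h m hm => congrArg Subtype.val (h ⟨m, hm⟩ trivial),
      fun h m _ => Subtype.ext (h m m.2)⟩
  have hηT : ∀ D, ∀ m ∈ T, η D m ∈ T := by
    intro D m hm
    have h1 : a • m = 0 := (hT a).1 ha m hm
    -- Applying `D` to `a m = 0` gives `a D(m) = -D(a) m`; a second factor `a` kills the right-hand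
    -- side.
    refine ⟨⟨a, ha'⟩ * ⟨a, ha'⟩, ?_⟩
    change (a * a) • η D m = 0
    have h2 := hη D a m
    rw [h1, hη0] at h2
    have h3 := congrArg (a • ·) h2
    simp only [smul_zero, smul_add, smul_smul] at h3
    rwa [mul_comm a (D a), mul_smul (D a), h1, smul_zero, add_zero, eq_comm] at h3
  have htop : (⊤ : Submodule A T).annihilator = ⊤ := by
    refine h.eq_top_of_stable _ (fun D b hb => ?_) fun hbot => ?_
    · rw [hT] at hb ⊢
      intro m hm
      have h2 := hη D b m
      rw [hb m hm, hη0, hb _ (hηT D m hm), zero_add] at h2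
      exact h2.symm
    · rw [hbot] at ha
      exact nonZeroDivisors.ne_zero ha' ha
  rw [Submodule.isTorsionFree_iff_torsion_eq_bot, eq_bot_iff]
  intro m hm
  have := (hT 1).1 (htop ▸ trivial) m hm
  rwa [one_smul] at this

end Coordinates

/-! ### Passing between modules over `U(A, G)` and over `D(A, Ĵ)` -/

noncomputable section
section EnvelopingModules

section Induction
variable {K A G : Type*} [CommRing K] [CommRing A] [Algebra K A] [LieRing G] [LieAlgebra K G]
  [Module A G] [LieRingModule G A]

@[elab_as_elim]
theorem WeakEnv.induction {p : WeakEnv K A G → Prop} (x : WeakEnv K A G)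
    (base : ∀ a, p (ofBase K A G a)) (lie : ∀ g, p (ofLie K A G g))
    (mul : ∀ x y, p x → p y → p (x * y)) (add : ∀ x y, p x → p y → p (x + y)) : p x := by
  obtain ⟨y, rfl⟩ := RingQuot.mkAlgHom_surjective K (WeakRel K A G) x
  change p (mk K A G y)
  induction y using TensorAlgebra.induction with
  | algebraMap r =>
    rw [AlgHom.commutes, ← (ofBase K A G).commutes]; exact base _
  | ι z => obtain ⟨a, g⟩ := z; rw [mk_ι]; exact add _ _ (base a) (lie g)
  | mul a b ha hb => rw [map_mul]; exact mul _ _ ha hb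
  | add a b ha hb => rw [map_add]; exact add _ _ ha hb

@[elab_as_elim]
theorem StrongEnv.induction {p : StrongEnv K A G → Prop} (x : StrongEnv K A G)
    (base : ∀ a, p (ofBase K A G a)) (lie : ∀ g, p (ofLie K A G g))
    (mul : ∀ x y, p x → p y → p (x * y)) (add : ∀ x y, p x → p y → p (x + y)) : p x := by
  obtain ⟨y, rfl⟩ := RingQuot.mkAlgHom_surjective K (StrongRel K A G) x
  change p (mk K A G y)
  induction y using WeakEnv.induction with
  | base a => exact base a
  | lie g => exact lie g
  | mul a b ha hb => rw [map_mul]; exact mul _ _ ha hb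
  | add a b ha hb => rw [map_add]; exact add _ _ ha hb

end Induction

variable {K A B G H : Type*} [CommRing K]
  [CommRing A] [Algebra K A] [LieRing G] [LieAlgebra K G]
  [Module A G] [LieRingModule G A] [LieRinehartRing A G] [LieRinehartAlgebra K A G]
  [CommRing B] [Algebra K B] [LieRing H] [LieAlgebra K H]
  [Module B H] [LieRingModule H B] [LieRinehartRing B H] [LieRinehartAlgebra K B H]
  {σ : A →ₐ[K] B}

namespace SmashLie

/-- The map `A # G → U(A, G)`, `a # g ↦ a · g`. -/
def toWeakEnv : SmashLie K A G →ₗ[K] WeakEnv K A G :=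
  TensorProduct.lift <| (LinearMap.mul K (WeakEnv K A G)).compl₁₂
    (WeakEnv.ofBase K A G).toLinearMap (WeakEnv.ofLie K A G)

theorem toWeakEnv_tmul (a : A) (g : G) :
    toWeakEnv (tmul K a g) = WeakEnv.ofBase K A G a * WeakEnv.ofLie K A G g := rfl

theorem toWeakEnv_smul (a : A) (x : SmashLie K A G) :
    toWeakEnv (a • x) = WeakEnv.ofBase K A G a * toWeakEnv x := by
  induction x using SmashLie.induction with
  | h0 => simp
  | ha x y hx hy => simp only [smul_add, map_add, hx, hy, mul_add]
  | ht b g => rw [smul_tmul', toWeakEnv_tmul, toWeakEnv_tmul, map_mul, mul_assoc]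

theorem toWeakEnv_mul_ofBase (x : SmashLie K A G) (b : A) :
    toWeakEnv x * WeakEnv.ofBase K A G b
      = WeakEnv.ofBase K A G b * toWeakEnv x + WeakEnv.ofBase K A G ⁅x, b⁆ := by
  induction x using SmashLie.induction with
  | h0 => simp
  | ha x y hx hy => simp only [map_add, add_lie, add_mul, mul_add, hx, hy]; abel
  | ht a g =>
    rw [toWeakEnv_tmul, tmul_lie, mul_assoc, WeakEnv.ofLie_mul_ofBase, mul_add, ← mul_assoc,
      ← map_mul, mul_comm a b, map_mul, map_mul, mul_assoc]

/-- The bracket of `A # G` is the commutator of the products `a · g` in `U(A, G)`, computed without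
using `a · g = ag`. Hence every weak module is a representation of `A # G`. -/
theorem toWeakEnv_lie (x y : SmashLie K A G) :
    toWeakEnv ⁅x, y⁆ = toWeakEnv x * toWeakEnv y - toWeakEnv y * toWeakEnv x := by
  induction x using SmashLie.induction with
  | h0 => simp
  | ha x x' hx hx' => simp only [map_add, add_lie, add_mul, mul_add, hx, hx']; abel
  | ht a g =>
  induction y using SmashLie.induction with
  | h0 => simp
  | ha x x' hx hx' => simp only [map_add, lie_add, add_mul, mul_add, hx, hx']; abel
  | ht b h =>
    have key : ∀ (a b : A) (g h : G), toWeakEnv (tmul K a g) * toWeakEnv (tmul K b h)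
        = WeakEnv.ofBase K A G (a * b) * (WeakEnv.ofLie K A G g * WeakEnv.ofLie K A G h)
          + WeakEnv.ofBase K A G (a * ⁅g, b⁆) * WeakEnv.ofLie K A G h := fun a b g h => by
      simp only [toWeakEnv_tmul, map_mul]
      rw [mul_assoc, ← mul_assoc (WeakEnv.ofLie K A G g), WeakEnv.ofLie_mul_ofBase]
      simp only [mul_add, add_mul, mul_assoc]
    rw [key, key, tmul_lie_tmul, map_add, map_sub]
    simp only [toWeakEnv_tmul, WeakEnv.ofLie_lie, mul_sub, mul_comm b a]
    abel

theorem map_toWeakEnv (F : LieRinehartAlgebra.Hom σ G H) (x : SmashLie K A G) :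
    WeakEnv.map F (toWeakEnv x) = toWeakEnv (SmashLie.map F x) := by
  induction x using SmashLie.induction with
  | h0 => simp
  | ha x y hx hy => simp only [map_add, hx, hy]
  | ht a g => simp only [toWeakEnv_tmul, map_mul, map_tmul, WeakEnv.map_ofBase, WeakEnv.map_ofLie]

/-- The strong relation in `D(A, Ĵ)` identifies `a · (1 # g)` with the jet `a # g`, so the dense
part `A # G` of `Ĵ` already acts through `U(A, G)`. -/
theorem weakToStrong_toWeakEnv (x : SmashLie K A G) :
    weakToStrong K A G (toWeakEnv x) = StrongEnv.ofLie K A (JetLie K A G) (JetLie.of x) := by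
  have hadd : ∀ x y : SmashLie K A G, JetLie.of (x + y) = JetLie.of x + JetLie.of y :=
    fun x y => map_add (AdicCompletion.of _ _) x y
  induction x using SmashLie.induction with
  | h0 =>
    have h : JetLie.of (0 : SmashLie K A G) = 0 := map_zero (AdicCompletion.of _ _)
    rw [h]; simp
  | ha x y hx hy => simp only [map_add, hx, hy, hadd]
  | ht a g =>
    have h : JetLie.of (tmul K a g) = a • JetLie.one K A G g := by
      rw [tmul_eq]; rfl
    rw [h, StrongEnv.ofLie_smul, toWeakEnv_tmul, map_mul, weakToStrong_ofBase, weakToStrong_ofLie]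

end SmashLie
open SmashLie

section StrongModule
variable {M : Type*} [AddCommGroup M] [Module (WeakEnv K A G) M]

variable (K A G M) in
/-- The ideal `J_N` of `A # G` acts by zero on `M`. -/
def KilledByJetIdeal (N : ℕ) : Prop :=
  ∀ x ∈ jetIdeal K A G N, ∀ m : M, toWeakEnv x • m = 0

theorem KilledByJetIdeal.mono {N N' : ℕ} (h : KilledByJetIdeal K A G M N) (hN : N ≤ N') :
    KilledByJetIdeal K A G M N' := fun x hx =>
  h x (Submodule.smul_mono_left (Ideal.pow_le_pow_right hN) hx)

theorem KilledByJetIdeal.smul_eq {N : ℕ} (h : KilledByJetIdeal K A G M N)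
    {x y : SmashLie K A G} (hxy : (Submodule.Quotient.mk x : _ ⧸ jetIdeal K A G N)
      = Submodule.Quotient.mk y) (m : M) : toWeakEnv x • m = toWeakEnv y • m := by
  rw [← sub_eq_zero, ← sub_smul, ← map_sub]
  exact h _ ((Submodule.Quotient.eq _).1 hxy) m

variable [Module K M] [IsScalarTower K (WeakEnv K A G) M]

/-- The action of jets on a module on which the ideal `J_N` acts by zero. -/
def jetAction (N : ℕ) (h : KilledByJetIdeal K A G M N) : JetLie K A G →ₗ[K] Module.End K M where
  toFun s := Algebra.lsmul K K M (toWeakEnv (s.exists_rep N).choose)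
  map_add' s t := by
    ext m
    have h1 := (s.exists_rep N).choose_spec N le_rfl
    have h2 := (t.exists_rep N).choose_spec N le_rfl
    have h3 := ((s + t).exists_rep N).choose_spec N le_rfl
    rw [JetLie.val_add, h1, h2, ← Submodule.Quotient.mk_add] at h3
    have h4 := h.smul_eq h3 m
    rw [map_add, add_smul] at h4
    exact h4.symm
  map_smul' c s := by
    ext m
    have h1 := (s.exists_rep N).choose_spec N le_rfl
    have h3 := ((c • s).exists_rep N).choose_spec N le_rfl
    rw [JetLie.val_smul', h1, ← Submodule.Quotient.mk_smul] at h3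
    have h4 := h.smul_eq h3 m
    rw [map_smul, smul_assoc] at h4
    exact h4.symm

theorem jetAction_apply {N : ℕ} (h : KilledByJetIdeal K A G M N) {s : JetLie K A G}
    {x : SmashLie K A G} (hx : s.val N = Submodule.Quotient.mk x) :
    jetAction N h s = Algebra.lsmul K K M (toWeakEnv x) := by
  ext m
  exact h.smul_eq (((s.exists_rep N).choose_spec N le_rfl).symm.trans hx) m

/-- The action of `D(A, Ĵ)` on a module over `U(A, G)` on which `J_N` acts by zero. -/
def strongAction (N : ℕ) (h : KilledByJetIdeal K A G M (N + 1)) :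
    StrongEnv K A (JetLie K A G) →ₐ[K] Module.End K M :=
  StrongEnv.lift ((Algebra.lsmul K K M).comp (WeakEnv.ofBase K A G)) (jetAction (N + 1) h)
    (fun s t => by
      obtain ⟨x, hx⟩ := s.exists_rep (N + 1)
      obtain ⟨y, hy⟩ := t.exists_rep (N + 1)
      rw [jetAction_apply h (hx _ le_rfl), jetAction_apply h (hy _ le_rfl),
        jetAction_apply h (JetLie.val_lie (hx _ le_rfl) (hy _ le_rfl)), toWeakEnv_lie, map_sub,
        map_mul, map_mul])
    (fun s a => by
      obtain ⟨x, hx⟩ := s.exists_rep (N + 1)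
      -- The order is `N + 1` rather than `N` so that the representative also computes the anchor,
      -- which is read off at order one.
      rw [jetAction_apply h (hx _ le_rfl), JetLie.lie_base (hx 1 (Nat.le_add_left 1 N)),
        AlgHom.comp_apply, AlgHom.comp_apply, ← map_mul, toWeakEnv_mul_ofBase, map_add, map_mul])
    (fun a s => by
      obtain ⟨x, hx⟩ := s.exists_rep (N + 1)
      have h1 : (a • s).val (N + 1) = Submodule.Quotient.mk (a • x) := by
        rw [JetLie.val_smul, hx _ le_rfl]; rfl
      rw [jetAction_apply h h1, jetAction_apply h (hx _ le_rfl), toWeakEnv_smul, map_mul]; rfl)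

variable {N : ℕ} (h : KilledByJetIdeal K A G M (N + 1))

theorem strongAction_ofBase (a : A) (m : M) :
    strongAction N h (StrongEnv.ofBase K A (JetLie K A G) a) m = WeakEnv.ofBase K A G a • m :=
  LinearMap.congr_fun (StrongEnv.lift_ofBase _ _ _ _ _ a) m

theorem strongAction_ofLie {s : JetLie K A G} {x : SmashLie K A G}
    (hx : s.val (N + 1) = Submodule.Quotient.mk x) (m : M) :
    strongAction N h (StrongEnv.ofLie K A (JetLie K A G) s) m = toWeakEnv x • m :=
  LinearMap.congr_fun ((StrongEnv.lift_ofLie _ _ _ _ _ s).trans (jetAction_apply h hx)) m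

/-- It suffices to check generators, and the jet `1 # g` is represented by `1 # g` at every order.
Thus the new action extends the old one, which gives essential surjectivity. -/
theorem strongAction_weakToStrong (x : WeakEnv K A G) (m : M) :
    strongAction N h (weakToStrong K A G x) m = x • m := by
  induction x using WeakEnv.induction generalizing m with
  | base a => rw [weakToStrong_ofBase, strongAction_ofBase]
  | lie g =>
    rw [weakToStrong_ofLie, strongAction_ofLie h (JetLie.val_one g (N + 1)), toWeakEnv_tmul,
      map_one, one_mul]
  | mul x y hx hy => rw [map_mul, map_mul, Module.End.mul_apply, hx, hy, mul_smul]
  | add x y hx hy => rw [map_add, map_add, LinearMap.add_apply, hx, hy, add_smul]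

/-- The action of `D(A, Ĵ)` on modules over `U(A, G)` is compatible with morphisms of Rinehart
pairs. -/
theorem map_strongAction {M' : Type*} [AddCommGroup M'] [Module (WeakEnv K B H) M'] [Module K M']
    [IsScalarTower K (WeakEnv K B H) M'] {N' : ℕ} (h' : KilledByJetIdeal K B H M' (N' + 1))
    (F : LieRinehartAlgebra.Hom σ G H) (r : M →+ M')
    (hr : ∀ (x : WeakEnv K A G) m, r (x • m) = WeakEnv.map F x • r m)
    (d : StrongEnv K A (JetLie K A G)) (m : M) :
    r (strongAction N h d m) = strongAction N' h' (StrongEnv.map (JetLie.map F) d) (r m) := by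
  induction d using StrongEnv.induction generalizing m with
  | base a =>
    rw [strongAction_ofBase, hr, StrongEnv.map_ofBase, strongAction_ofBase, WeakEnv.map_ofBase]
  | lie s =>
    -- The two modules may be killed at different orders; one representative has to serve both.
    obtain ⟨x, hx⟩ := s.exists_rep (max (N + 1) (N' + 1))
    rw [strongAction_ofLie h (hx _ (le_max_left _ _)), hr, StrongEnv.map_ofLie,
      strongAction_ofLie h' (JetLie.val_map F (hx _ (le_max_right _ _))), map_toWeakEnv]
  | mul x y hx hy => simp only [map_mul, Module.End.mul_apply, hx, hy]
  | add x y hx hy => simp only [map_add, LinearMap.add_apply, hx, hy]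

end StrongModule

/-- A map that is linear over `U(A, G)` is linear over `D(A, Ĵ)` if some ideal of jets of high order
acts by zero on both modules. -/
theorem map_strongEnv_smul {M M' : Type*} [AddCommGroup M] [AddCommGroup M']
    [Module (StrongEnv K A (JetLie K A G)) M] [Module (StrongEnv K A (JetLie K A G)) M']
    (f : M →+ M')
    (hf : ∀ (x : WeakEnv K A G) m, f (weakToStrong K A G x • m) = weakToStrong K A G x • f m)
    {N N' : ℕ}
    (hN : ∀ s : JetLie K A G, s.val N = 0 → ∀ m : M, StrongEnv.ofLie K A _ s • m = 0)
    (hN' : ∀ s : JetLie K A G, s.val N' = 0 → ∀ m : M', StrongEnv.ofLie K A _ s • m = 0)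
    (d : StrongEnv K A (JetLie K A G)) (m : M) : f (d • m) = d • f m := by
  induction d using StrongEnv.induction generalizing m with
  | base a => rw [← weakToStrong_ofBase, hf]
  | lie s =>
    -- The jet is approximated by an element of `A # G`, which acts through `U(A, G)`, up to an
    -- error acting by zero on both modules.
    obtain ⟨x, hx⟩ := s.exists_rep (max N N')
    have key : ∀ n ≤ max N N', (s - JetLie.of x).val n = 0 := fun n hn => by
      rw [JetLie.val_sub, hx n hn, JetLie.val_of, sub_self]
    have h1 := hN _ (key N (le_max_left _ _)) m
    have h2 := hN' _ (key N' (le_max_right _ _)) (f m)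
    rw [map_sub, sub_smul, sub_eq_zero, ← weakToStrong_toWeakEnv] at h1 h2
    rw [h1, h2, hf]
  | mul x y hx hy => rw [mul_smul, hx, hy, mul_smul]
  | add x y hx hy => rw [add_smul, map_add, hx, hy, add_smul]

end EnvelopingModules

/-! ### Nilpotency on affine opens with coordinates -/

section Coordinates
variable {K A : Type*} [Field K] [IsAlgClosed K] [CharZero K] [CommRing A] [IsDomain A]
  [Algebra K A] [Algebra.FiniteType K A] {M : Type*} [AddCommGroup M] [Module A M]
  [Module.Finite A M]
open SmashLie

theorem HasCoordinates.isTorsionFree_of_weakEnv (h : HasCoordinates K A)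
    [Module (WeakEnv K A (Derivation K A A)) M]
    (hM : ∀ (a : A) (m : M), WeakEnv.ofBase K A (Derivation K A A) a • m = a • m) :
    Module.IsTorsionFree A M :=
  h.isTorsionFree (fun D m => WeakEnv.ofLie K A _ D • m) (fun D a m => by
    rw [← hM, ← mul_smul, WeakEnv.ofLie_mul_ofBase, add_smul, mul_smul, hM, hM]; rfl)
    fun D => smul_zero _

/-- The module is torsion-free by the stable ideal argument. Either there are no vector fields at
all, or some `D(a) = 1` and the nilpotency argument applies. -/
theorem HasCoordinates.exists_killedByJetIdeal (h : HasCoordinates K A)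
    [Module (WeakEnv K A (Derivation K A A)) M]
    (hM : ∀ (a : A) (m : M), WeakEnv.ofBase K A (Derivation K A A) a • m = a • m) :
    ∃ N, KilledByJetIdeal K A (Derivation K A A) M N := by
  have : IsNoetherianRing A := Algebra.FiniteType.isNoetherianRing K A
  have : CharZero A := charZero_of_injective_algebraMap (algebraMap K A).injective
  have := h.isTorsionFree_of_weakEnv hM
  rcases h.subsingleton_or_exists with hV | ⟨D, a, hDa⟩
  · have : Subsingleton (SmashLie K A (Derivation K A A)) :=
      inferInstanceAs (Subsingleton (A ⊗[K] Derivation K A A))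
    exact ⟨0, fun x _ m => by rw [Subsingleton.elim x 0, map_zero, zero_smul]⟩
  · obtain ⟨N, hN⟩ := SmashLie.exists_forall_mem_jetIdeal D a hDa
      ((Module.toAddMonoidEnd (WeakEnv K A (Derivation K A A)) M).toAddMonoidHom.comp
        toWeakEnv.toAddMonoidHom)
      (fun x y => by
        change Module.toAddMonoidEnd _ M (toWeakEnv ⁅x, y⁆) = _
        rw [toWeakEnv_lie, map_sub, map_mul, map_mul]; rfl)
      (fun x b m => by
        change toWeakEnv x • b • m = b • toWeakEnv x • m + _
        rw [← hM, ← mul_smul, toWeakEnv_mul_ofBase, add_smul, mul_smul, hM, hM])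
    exact ⟨N, fun x hx m => DFunLike.congr_fun (hN x hx) m⟩

/-- No continuity of the jet action is assumed, so knowing how `A # V` acts is not enough: the
nilpotency argument is run on `Ĵ` itself. -/
theorem HasCoordinates.exists_ofLie_smul_eq_zero (h : HasCoordinates K A)
    [Module.IsTorsionFree A M] [Module (StrongEnv K A (JetLie K A (Derivation K A A))) M]
    (hM : ∀ (a : A) (m : M), StrongEnv.ofBase K A (JetLie K A (Derivation K A A)) a • m = a • m) :
    ∃ N, ∀ s : JetLie K A (Derivation K A A), s.val N = 0 →
      ∀ m : M, StrongEnv.ofLie K A _ s • m = 0 := by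
  have : IsNoetherianRing A := Algebra.FiniteType.isNoetherianRing K A
  have : CharZero A := charZero_of_injective_algebraMap (algebraMap K A).injective
  rcases h.subsingleton_or_exists with hV | ⟨D, a, hDa⟩
  · have : Subsingleton (SmashLie K A (Derivation K A A)) :=
      inferInstanceAs (Subsingleton (A ⊗[K] Derivation K A A))
    refine ⟨0, fun s _ m => ?_⟩
    have hs : s = 0 := JetLie.ext fun n => by
      obtain ⟨x, hx⟩ := s.exists_rep n
      rw [hx n le_rfl, Subsingleton.elim x 0]; rfl
    rw [hs, map_zero, zero_smul]
  · obtain ⟨N, hN⟩ := JetLie.exists_forall_val_eq_zero (KaehlerDifferential.ideal_fg K A) D a hDa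
      ((Module.toAddMonoidEnd (StrongEnv K A (JetLie K A (Derivation K A A))) M).toAddMonoidHom.comp
        (StrongEnv.ofLie K A _).toAddMonoidHom)
      (fun x y => by
        change Module.toAddMonoidEnd _ M (StrongEnv.ofLie K A _ ⁅x, y⁆) = _
        rw [StrongEnv.ofLie_lie, map_sub, map_mul, map_mul]; rfl)
      (fun x b m => by
        change StrongEnv.ofLie K A _ x • b • m = b • StrongEnv.ofLie K A _ x • m + _
        rw [← hM, ← mul_smul, StrongEnv.ofLie_mul_ofBase, add_smul, mul_smul, hM, hM])
    exact ⟨N, fun s hs m => DFunLike.congr_fun (hN s hs) m⟩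

end Coordinates
end

/-! ### From coordinate charts to all affine opens of a smooth scheme -/

noncomputable section
section SmoothSchemes
open Opposite

theorem eq_bot_of_not_nonempty {X : Scheme.{u}} {U : X.Opens} (h : ¬ Nonempty U) : U = ⊥ := by
  rw [not_nonempty_iff] at h
  ext x
  exact ⟨fun hx => (h.false ⟨x, hx⟩).elim, fun hx => hx.elim⟩

variable {K : Type u} [Field K] {X : Scheme.{u}} [X.Over (Spec (CommRingCat.of K))]

theorem smooth_sections [Smooth (X ↘ Spec (CommRingCat.of K))] (U : X.affineOpens) :
    Algebra.Smooth K Γ(X, U.1) := by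
  have h1 := (X ↘ Spec (CommRingCat.of K)).smooth_appLE (isAffineOpen_top _) U.2 le_top
  have h2 := RingHom.Smooth.propertyIsLocal.respectsIso.2 _
    (Scheme.ΓSpecIso (CommRingCat.of K)).symm.commRingCatIsoToRingEquiv h1
  exact h2

/-- A smooth algebra is locally standard smooth, and standard smooth algebras have a basis of exact
differentials. -/
theorem span_hasCoordinates_eq_top [Smooth (X ↘ Spec (CommRingCat.of K))] (U : X.affineOpens) :
    Ideal.span {f : Γ(X, U.1) | HasCoordinates K Γ(X, (X.affineBasicOpen f).1)} = ⊤ := by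
  have := smooth_sections (K := K) U
  obtain ⟨s, hs, h⟩ := Algebra.Smooth.exists_span_eq_top_isStandardSmooth K Γ(X, U.1)
  rw [eq_top_iff, ← hs]
  refine Ideal.span_mono fun f hf => ?_
  have := h f hf
  have : IsLocalization.Away f Γ(X, X.basicOpen f) := U.2.isLocalization_basicOpen f
  have : IsScalarTower K Γ(X, U.1) Γ(X, X.basicOpen f) :=
    IsScalarTower.of_algebraMap_eq fun k => ((resAlgHom K (X.basicOpen_le f)).commutes k).symm
  have : Algebra.IsStandardSmooth K Γ(X, X.basicOpen f) := Algebra.IsStandardSmooth.of_algEquiv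
    ((IsLocalization.algEquiv (Submonoid.powers f) (Localization.Away f)
      Γ(X, X.basicOpen f)).restrictScalars K)
  exact (Algebra.IsStandardSmooth.iff_exists_basis_kaehlerDifferential.1 this).2

/-- The action of `U(𝒜, 𝒱)(U)` on the sections over an affine open set `U`. -/
instance weakSectionsModule (M : PresheafOfModules.{u} (weakAlgebra K X)) (U : X.affineOpens) :
    Module (WeakEnv K Γ(X, U.1) (VectorFields K U)) (M.obj (op U)) := (M.obj (op U)).isModule

instance weakSectionsBaseModule (M : PresheafOfModules.{u} (weakAlgebra K X)) (U : X.affineOpens) :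
    Module Γ(X, U.1) (M.obj (op U)) :=
  Module.compHom _ (WeakEnv.ofBase K Γ(X, U.1) (VectorFields K U)).toRingHom

/-- The action of `D(𝒜, 𝒥̂)(U)` on the sections over an affine open set `U`. -/
instance strongSectionsModule (M : PresheafOfModules.{u} (strongAlgebra K X)) (U : X.affineOpens) :
    Module (StrongEnv K Γ(X, U.1) (VectorFieldJets K U)) (M.obj (op U)) := (M.obj (op U)).isModule

instance strongSectionsBaseModule (M : PresheafOfModules.{u} (strongAlgebra K X))
    (U : X.affineOpens) : Module Γ(X, U.1) (M.obj (op U)) :=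
  Module.compHom _ (StrongEnv.ofBase K Γ(X, U.1) (VectorFieldJets K U)).toRingHom

/-- Restriction of the sections of a module over `U(𝒜, 𝒱)`. -/
def weakRes (M : PresheafOfModules.{u} (weakAlgebra K X)) {U W : X.affineOpens} (h : W ≤ U) :
    M.obj (op U) →+ M.obj (op W) := (M.map (homOfLE h).op).hom.toAddMonoidHom

theorem weakRes_smul (M : PresheafOfModules.{u} (weakAlgebra K X)) {U W : X.affineOpens}
    (h : W ≤ U) (x : WeakEnv K Γ(X, U.1) (VectorFields K U)) (m : M.obj (op U)) :
    weakRes M h (x • m) = WeakEnv.map (resVectorFields K h) x • weakRes M h m :=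
  (M.map (homOfLE h).op).hom.map_smul x m

/-- Restriction of the sections of a module over `D(𝒜, 𝒥̂)`. -/
def strongRes (M : PresheafOfModules.{u} (strongAlgebra K X)) {U W : X.affineOpens} (h : W ≤ U) :
    M.obj (op U) →+ M.obj (op W) := (M.map (homOfLE h).op).hom.toAddMonoidHom

theorem strongRes_smul (M : PresheafOfModules.{u} (strongAlgebra K X)) {U W : X.affineOpens}
    (h : W ≤ U) (x : StrongEnv K Γ(X, U.1) (VectorFieldJets K U)) (m : M.obj (op U)) :
    strongRes M h (x • m) = StrongEnv.map (resJets K h) x • strongRes M h m :=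
  (M.map (homOfLE h).op).hom.map_smul x m

theorem weakRes_base_smul (M : PresheafOfModules.{u} (weakAlgebra K X)) {U W : X.affineOpens}
    (h : W ≤ U) (a : Γ(X, U.1)) (m : M.obj (op U)) :
    weakRes M h (a • m) = resAlgHom K h a • weakRes M h m := by
  refine (weakRes_smul M h (WeakEnv.ofBase K _ _ a) m).trans ?_
  rw [WeakEnv.map_ofBase]
  rfl

theorem IsFinitelyGeneratedSheaf.restrictScalars_weakToStrong
    {M : PresheafOfModules.{u} (strongAlgebra K X)}
    (h : IsFinitelyGeneratedSheaf
      ((PresheafOfModules.restrictScalars (baseToStrong K X)).obj M)) :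
    IsFinitelyGeneratedSheaf ((PresheafOfModules.restrictScalars (baseToWeak K X)).obj
      ((PresheafOfModules.restrictScalars (weakToStrongAlgebra K X)).obj M)) := by
  rw [← baseToWeak_comp] at h
  exact h

variable [IsIntegral X]

theorem resAlgHom_ne_zero {U W : X.Opens} [Nonempty W] (h : W ≤ U) {a : Γ(X, U)} (ha : a ≠ 0) :
    resAlgHom K h a ≠ 0 := by
  have := map_injective_of_isIntegral X (homOfLE h)
  exact fun h0 => ha (this (h0.trans (map_zero _).symm))

variable [IsAlgClosed K] [CharZero K] [Smooth (X ↘ Spec (CommRingCat.of K))]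

/-- If `a m = 0` with `a ≠ 0`, then `m` vanishes on every basic open `U_f` with coordinates, so a
power of `f` kills `m`. These `f` generate the unit ideal and lie in the radical of the annihilator
of `m`, hence `m = 0`. -/
theorem weakSections_isTorsionFree (M : PresheafOfModules.{u} (weakAlgebra K X))
    (hM : IsFinitelyGeneratedSheaf ((PresheafOfModules.restrictScalars (baseToWeak K X)).obj M))
    (U : X.affineOpens) [Nonempty U.1] : Module.IsTorsionFree Γ(X, U.1) (M.obj (op U)) := by
  have : IsDomain Γ(X, U.1) := inferInstance
  refine Module.IsTorsionFree.of_smul_eq_zero fun a m ham => ?_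
  by_contra! hne
  let I : Ideal Γ(X, U.1) := LinearMap.ker (LinearMap.toSpanSingleton Γ(X, U.1) (M.obj (op U)) m)
  have hI : {f : Γ(X, U.1) | HasCoordinates K Γ(X, (X.affineBasicOpen f).1)} ⊆ I.radical := by
    intro f hf
    rcases isEmpty_or_nonempty (X.affineBasicOpen f).1 with he | he
    · rw [(basicOpen_eq_bot_iff f).1 (eq_bot_of_not_nonempty (not_nonempty_iff.2 he))]
      exact zero_mem _
    · have : Algebra.Smooth K Γ(X, (X.affineBasicOpen f).1) := smooth_sections _
      have : Module.Finite Γ(X, (X.affineBasicOpen f).1) (M.obj (op (X.affineBasicOpen f))) :=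
        hM.finite _
      have := HasCoordinates.isTorsionFree_of_weakEnv hf (M := M.obj (op (X.affineBasicOpen f)))
        fun _ _ => rfl
      have h1 := congrArg (weakRes M (X.affineBasicOpen_le f)) ham
      rw [weakRes_base_smul, map_zero] at h1
      have h2 := (smul_eq_zero.1 h1).resolve_left (resAlgHom_ne_zero _ hne.1)
      obtain ⟨n, hn⟩ := hM.pow_smul_eq_zero U f m h2
      exact ⟨n, hn⟩
  have h1 := Ideal.span_le.2 hI
  rw [span_hasCoordinates_eq_top, top_le_iff, Ideal.radical_eq_top, Ideal.eq_top_iff_one] at h1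
  have h2 : (1 : Γ(X, U.1)) • m = 0 := h1
  rw [one_smul] at h2
  exact hne.2 h2

/-- A nonempty affine open set contains a nonempty basic open set with coordinates. -/
theorem exists_hasCoordinates (U : X.affineOpens) [Nonempty U.1] :
    ∃ f : Γ(X, U.1), f ≠ 0 ∧ Nonempty (X.affineBasicOpen f).1 ∧
      HasCoordinates K Γ(X, (X.affineBasicOpen f).1) := by
  by_contra! h
  have h1 : Ideal.span {f : Γ(X, U.1) | HasCoordinates K Γ(X, (X.affineBasicOpen f).1)} ≤ ⊥ := by
    refine Ideal.span_le.2 fun f hf => ?_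
    by_contra hne
    refine h f hne ?_ hf
    by_contra he
    exact hne ((basicOpen_eq_bot_iff f).1 (eq_bot_of_not_nonempty he))
  rw [span_hasCoordinates_eq_top] at h1
  exact bot_ne_top (top_le_iff.1 h1)

/-- One nonempty chart `U_f` suffices: jets in `J_N` restrict to jets in `J_N`, so their action on a
section vanishes over `U_f`, is killed by a power of `f`, and is zero by torsion-freeness. -/
theorem exists_killedByJetIdeal_sections (M : PresheafOfModules.{u} (weakAlgebra K X))
    (hM : IsFinitelyGeneratedSheaf ((PresheafOfModules.restrictScalars (baseToWeak K X)).obj M))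
    (U : X.affineOpens) :
    ∃ N, KilledByJetIdeal K Γ(X, U.1) (VectorFields K U) (M.obj (op U)) N := by
  by_cases hU : Nonempty U.1
  · have := weakSections_isTorsionFree M hM U
    obtain ⟨f, hf0, hne, hf⟩ := exists_hasCoordinates (K := K) U
    have : Algebra.Smooth K Γ(X, (X.affineBasicOpen f).1) := smooth_sections _
    have : Module.Finite Γ(X, (X.affineBasicOpen f).1) (M.obj (op (X.affineBasicOpen f))) :=
      hM.finite _
    obtain ⟨N, hN⟩ := hf.exists_killedByJetIdeal (M := M.obj (op (X.affineBasicOpen f)))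
      fun _ _ => rfl
    refine ⟨N, fun x hx m => ?_⟩
    have h1 := weakRes_smul M (X.affineBasicOpen_le f) (SmashLie.toWeakEnv x) m
    rw [SmashLie.map_toWeakEnv, hN _ (SmashLie.map_mem_jetIdeal _ _ _ hx)] at h1
    obtain ⟨n, hn⟩ := hM.pow_smul_eq_zero U f _ h1
    exact (smul_eq_zero.1 (show f ^ n • (SmashLie.toWeakEnv x • m) = 0 from hn)).resolve_left
      (pow_ne_zero n hf0)
  -- Over the empty set the functions form the zero ring, so the sections vanish.
  · have : Subsingleton Γ(X, U.1) := by
      rw [eq_bot_of_not_nonempty hU]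
      infer_instance
    have := Module.subsingleton Γ(X, U.1) (M.obj (op U))
    exact ⟨0, fun x _ m => Subsingleton.elim _ _⟩

theorem exists_ofLie_smul_eq_zero_sections (M : PresheafOfModules.{u} (strongAlgebra K X))
    (hM : IsFinitelyGeneratedSheaf ((PresheafOfModules.restrictScalars (baseToStrong K X)).obj M))
    (U : X.affineOpens) :
    ∃ N, ∀ s : VectorFieldJets K U, s.val N = 0 →
      ∀ m : M.obj (op U), StrongEnv.ofLie K Γ(X, U.1) _ s • m = 0 := by
  -- Torsion-freeness concerns only the `𝒜`-module, so it is inherited from the underlying module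
  -- over `U(𝒜, 𝒱)`.
  have htf : ∀ (U : X.affineOpens) [Nonempty U.1],
      Module.IsTorsionFree Γ(X, U.1) (M.obj (op U)) := fun U _ => by
    have : IsDomain Γ(X, U.1) := inferInstance
    have := weakSections_isTorsionFree _ hM.restrictScalars_weakToStrong U
    refine Module.IsTorsionFree.of_smul_eq_zero fun a m ham => ?_
    have h1 : (weakToStrong K Γ(X, U.1) (VectorFields K U) (WeakEnv.ofBase K _ _ a)) • m = 0 := by
      rw [weakToStrong_ofBase]; exact ham
    exact (smul_eq_zero (r := a) (M := ((PresheafOfModules.restrictScalars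
      (weakToStrongAlgebra K X)).obj M).obj (op U)) (m := m)).1 h1
  by_cases hU : Nonempty U.1
  · have := htf U
    obtain ⟨f, hf0, hne, hf⟩ := exists_hasCoordinates (K := K) U
    have := htf (X.affineBasicOpen f)
    have : Algebra.Smooth K Γ(X, (X.affineBasicOpen f).1) := smooth_sections _
    have : Module.Finite Γ(X, (X.affineBasicOpen f).1) (M.obj (op (X.affineBasicOpen f))) :=
      hM.finite _
    obtain ⟨N, hN⟩ := hf.exists_ofLie_smul_eq_zero (M := M.obj (op (X.affineBasicOpen f)))
      fun _ _ => rfl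
    refine ⟨N, fun s hs m => ?_⟩
    have h1 := strongRes_smul M (X.affineBasicOpen_le f) (StrongEnv.ofLie K _ _ s) m
    have h0 : (resJets K (X.affineBasicOpen_le f) s).val N = 0 :=
      (JetLie.val_map (resVectorFields K (X.affineBasicOpen_le f)) (x := 0) hs).trans
        (by rw [map_zero]; rfl)
    rw [StrongEnv.map_ofLie] at h1
    replace h1 := h1.trans (hN _ h0 _)
    obtain ⟨n, hn⟩ := hM.pow_smul_eq_zero U f _ h1
    exact (smul_eq_zero.1 (show f ^ n • (StrongEnv.ofLie K Γ(X, U.1) _ s • m) = 0 from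
      hn)).resolve_left (pow_ne_zero n hf0)
  · have : Subsingleton Γ(X, U.1) := by
      rw [eq_bot_of_not_nonempty hU]
      infer_instance
    have := Module.subsingleton Γ(X, U.1) (M.obj (op U))
    exact ⟨0, fun x _ m => Subsingleton.elim _ _⟩

end SmoothSchemes
end

/-! ### The equivalence of categories -/

noncomputable section
section Equivalence
open Opposite

variable {K : Type u} [Field K] {X : Scheme.{u}} [X.Over (Spec (CommRingCat.of K))]

instance weakSectionsScalarModule (M : PresheafOfModules.{u} (weakAlgebra K X))
    (U : X.affineOpens) : Module K (M.obj (op U)) :=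
  Module.compHom _ (algebraMap K (WeakEnv K Γ(X, U.1) (VectorFields K U)))

instance (M : PresheafOfModules.{u} (weakAlgebra K X)) (U : X.affineOpens) :
    IsScalarTower K (WeakEnv K Γ(X, U.1) (VectorFields K U)) (M.obj (op U)) where
  smul_assoc c x m := by rw [Algebra.smul_def, mul_smul]; rfl

/-- A module over `U(𝒜, 𝒱)` on whose sections jets of sufficiently high order act by zero, as a
module over `D(𝒜, 𝒥̂)`. -/
def strongOfWeak (M : PresheafOfModules.{u} (weakAlgebra K X)) (N : X.affineOpens → ℕ)
    (h : ∀ U, KilledByJetIdeal K Γ(X, U.1) (VectorFields K U) (M.obj (op U)) (N U + 1)) :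
    PresheafOfModules.{u} (strongAlgebra K X) where
  obj U := @ModuleCat.of ((strongAlgebra K X).obj U) _ (M.obj U) _
    (Module.compHom (M.obj (op U.unop)) (strongAction (N U.unop) (h U.unop)).toRingHom)
  map {U W} f :=
    let _ := Module.compHom (M.obj (op U.unop)) (strongAction (N U.unop) (h U.unop)).toRingHom
    let _ := Module.compHom (M.obj (op W.unop)) (strongAction (N W.unop) (h W.unop)).toRingHom
    ModuleCat.ofHom (R := (strongAlgebra K X).obj U)
      (X := @ModuleCat.of ((strongAlgebra K X).obj U) _ (M.obj U) _
        (Module.compHom (M.obj (op U.unop)) (strongAction (N U.unop) (h U.unop)).toRingHom))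
      (Y := (ModuleCat.restrictScalars ((strongAlgebra K X).map f).hom).obj
        (@ModuleCat.of ((strongAlgebra K X).obj W) _ (M.obj W) _
          (Module.compHom (M.obj (op W.unop)) (strongAction (N W.unop) (h W.unop)).toRingHom)))
      { toFun := M.map f
        map_add' := map_add (M.map f).hom
        map_smul' := fun d m => map_strongAction (h U.unop) (h W.unop)
          (resVectorFields K (leOfHom f.unop)) (weakRes M (leOfHom f.unop))
          (weakRes_smul M (leOfHom f.unop)) d m }
  map_id U := by
    ext m
    exact ConcreteCategory.congr_hom (M.map_id U) m
  map_comp f g := by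
    ext m
    exact ConcreteCategory.congr_hom (M.map_comp f g) m

/-- Restricting the scalars of `strongOfWeak` gives back the original module. -/
def restrictScalarsStrongOfWeakIso (M : PresheafOfModules.{u} (weakAlgebra K X))
    (N : X.affineOpens → ℕ)
    (h : ∀ U, KilledByJetIdeal K Γ(X, U.1) (VectorFields K U) (M.obj (op U)) (N U + 1)) :
    (PresheafOfModules.restrictScalars (weakToStrongAlgebra K X)).obj (strongOfWeak M N h) ≅ M :=
  PresheafOfModules.isoMk
    (fun U =>
      let M' := ((PresheafOfModules.restrictScalars (weakToStrongAlgebra K X)).obj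
        (strongOfWeak M N h)).obj U
      LinearEquiv.toModuleIso (R := (weakAlgebra K X).obj U) (m₁ := M'.isModule)
        (m₂ := (M.obj U).isModule)
        { AddEquiv.refl (M.obj U) with
          map_smul' := fun x m => strongAction_weakToStrong (h U.unop) x m })
    fun U W f => by ext m; rfl

theorem IsFinitelyGeneratedSheaf.strongOfWeak {M : PresheafOfModules.{u} (weakAlgebra K X)}
    (hM : IsFinitelyGeneratedSheaf ((PresheafOfModules.restrictScalars (baseToWeak K X)).obj M))
    {N : X.affineOpens → ℕ}
    (h : ∀ U, KilledByJetIdeal K Γ(X, U.1) (VectorFields K U) (M.obj (op U)) (N U + 1)) :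
    IsFinitelyGeneratedSheaf ((PresheafOfModules.restrictScalars (baseToStrong K X)).obj
      (_root_.strongOfWeak M N h)) := by
  let M₁ := (PresheafOfModules.restrictScalars (baseToWeak K X)).obj M
  let M₂ := (PresheafOfModules.restrictScalars (baseToStrong K X)).obj (_root_.strongOfWeak M N h)
  have hs : ∀ (U : X.affineOpens) (a : Γ(X, U.1)) (m : M₁.obj (op U)),
      a • (show M₂.obj (op U) from m) = (show M₂.obj (op U) from a • m) :=
    fun U a m => strongAction_ofBase (h U) a m
  refine ⟨fun U => ?_, fun U f m => ?_, fun U f m hm => ?_⟩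
  · have := hM.finite U
    let e : M₁.obj (op U) →ₗ[Γ(X, U.1)] M₂.obj (op U) :=
      { toFun := fun m => m
        map_add' := fun _ _ => rfl
        map_smul' := fun a m => (hs U a m).symm }
    exact Module.Finite.of_surjective e fun m => ⟨m, rfl⟩
  · obtain ⟨n, m', hm'⟩ := hM.exists_pow_smul_eq U f m
    exact ⟨n, m', (hs _ _ m).trans hm'⟩
  · obtain ⟨n, hn⟩ := hM.pow_smul_eq_zero U f m hm
    exact ⟨n, (hs _ _ m).trans hn⟩

variable [IsIntegral X] [IsAlgClosed K] [CharZero K] [Smooth (X ↘ Spec (CommRingCat.of K))]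

variable (K X) in
-- Jets of high order act by zero on source and target, so linearity over `U(𝒜, 𝒱)` upgrades to
-- linearity over `D(𝒜, 𝒥̂)` on each affine open.
theorem strongToWeak_full : (strongToWeak K X).Full where
  map_surjective {M M'} g := by
    let φ (U : X.affineOpens) : M.obj.obj (op U) →+ M'.obj.obj (op U) :=
      (g.hom.app (op U)).hom.toAddMonoidHom
    have hlin : ∀ (U : X.affineOpens) (d : StrongEnv K Γ(X, U.1) (VectorFieldJets K U))
        (m : M.obj.obj (op U)), φ U (d • m) = d • φ U m := by
      intro U
      obtain ⟨N, hN⟩ := exists_ofLie_smul_eq_zero_sections M.obj M.property U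
      obtain ⟨N', hN'⟩ := exists_ofLie_smul_eq_zero_sections M'.obj M'.property U
      exact map_strongEnv_smul (φ U) (fun x m => (g.hom.app (op U)).hom.map_smul x m) hN hN'
    let g' : M.obj ⟶ M'.obj :=
      { app := fun U => ModuleCat.ofHom (R := (strongAlgebra K X).obj U)
          { toFun := φ U.unop
            map_add' := map_add _
            map_smul' := hlin U.unop }
        naturality := fun {U W} f => by
          ext m
          exact PresheafOfModules.naturality_apply g.hom f m }
    refine ⟨ObjectProperty.homMk g', ?_⟩
    ext U m
    rfl

variable (K X) in
theorem strongToWeak_essSurj : (strongToWeak K X).EssSurj where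
  mem_essImage M := by
    choose N hN using fun U => exists_killedByJetIdeal_sections M.obj M.property U
    -- The extension needs a positive order. The orders are chosen separately for each affine open;
    -- no uniform bound is required.
    have h U := (hN U).mono (Nat.le_succ _)
    exact ⟨⟨strongOfWeak M.obj N h, M.property.strongOfWeak h⟩,
      ⟨ObjectProperty.isoMk _ (restrictScalarsStrongOfWeakIso M.obj N h)⟩⟩

end Equivalence
end
theorem corollary21 {K : Type u} [Field K] [IsAlgClosed K] [CharZero K]
    (X : Scheme.{u}) [X.Over (Spec (CommRingCat.of K))] [IsIntegral X]
    [Smooth (X ↘ Spec (CommRingCat.of K))] :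
    ∃ e : WeakFin K X ≌ StrongFin K X, Nonempty (e.inverse ≅ strongToWeak K X) := by
  -- Restriction of scalars leaves the underlying maps unchanged.
  have : (strongToWeak K X).Faithful := by
    unfold strongToWeak
    infer_instance
  have := strongToWeak_full K X
  have := strongToWeak_essSurj K X
  have : (strongToWeak K X).IsEquivalence := { }
  exact ⟨(strongToWeak K X).asEquivalence.symm, ⟨Iso.refl _⟩⟩
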